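/- Let $q, r, T$ be real numbers with $0<q<r<qe$ and $T>0$. Put $\Omega=(-1,1)$, $\alpha=(r-q-1)/2$, $\beta=\alpha^2+r$, $\varphi(x)=e^{\alpha x}\max(e^x-1,0)$ and $x_0=\log(r/q)\in(0,1)$. For a time step $h>0$, the discrete Morse semiflow $\{u_m\}_{m=0}^{[T/h]}$ is defined by $u_0=\varphi$ and, for $m=1,\dots,[T/h]$, by letting $u_m$ be the minimizer of $$J_m(v)=\frac12\int_\Omega\Big\{\frac{|v-u_{m-1}|^2}{h}+(v_x)^2+\beta v^2\Big\}\,dx$$ over $\mathcal K=\{v\in H^1(\Omega)\mid v-\varphi\in H^1_0(\Omega),\ v\ge\varphi \text{ a.e. in }\Omega\}$; here $[\cdot]$ is the integer part, and $u_m$ is identified with its representative that is continuous on $\overline\Omega=[-1,1]$. **Theorem.** There exist $x_4\in(0,x_0)$ and $h_1\in(0,1)$ such that for each $h\in(0,h_1)$ one has $u_m\in W^{2,\infty}(\Omega)$ for all $m=1,\dots,[T/h]$, and the following estimates hold. (1) There are $L_4,L_5>0$, independent of $h$ and $m$, such that for each $h\in(0,h_1)$ and $m=1,\dots,[T/h]$,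 $$\frac{|u_m(x)-u_{m-1}(x)|}{h}\le\begin{cases}L_4\max\Big\{\dfrac1{\sqrt{mh}},\sqrt{\dfrac{|\log h|}{L_5}}\Big\} & \text{for } x\in\overline\Omega,\ |x|<x_4,\\[2mm] L_4\sqrt{\dfrac{|\log h|}{L_5}} & \text{for } x\in\overline\Omega,\ |x|\ge x_4,\end{cases}$$ $$|u_{m,xx}(x)|\le\begin{cases}L_4\max\Big\{\dfrac1{\sqrt{mh}},\sqrt{\dfrac{|\log h|}{L_5}}\Big\} & \text{for a.e. } x\in\Omega \text{ with } |x|<x_4,\\[2mm] L_4\sqrt{\dfrac{|\log h|}{L_5}} & \text{for a.e. } x\in\Omega \text{ with } |x|\ge x_4,\end{cases}$$ where $u_{m,xx}$ is the second weak derivative of $u_m$. (2) There are $L_6,L_7>0$, independent of $h$, $m$, $n$, $x$ and $y$, such that $$|u_m(x)-u_n(y)|\le\begin{cases}L_6\big(|(m-n)h|^{1/2}+|x-y|\big) & \text{if } m,n\le L_7(h|\log h|)^{-1},\\[1mm] L_6\big(|(m-n)h|\sqrt{|\log h|}+|x-y|\big) & \text{if } m,n\ge L_7(h|\log h|)^{-1},\end{cases}$$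 for all $m,n=0,1,\dots,[T/h]$, $x,y\in\overline\Omega$ and $h\in(0,h_1)$. The numbers $x_4$, $h_1$, $L_4,\dots,L_7$ may depend on $r$, $q$ and $T$. -/

import Mathlib

open MeasureTheory Set

namespace DMSBS

noncomputable section

/-- The space interval `Ω = (-1, 1)`. -/
def Ω : TopologicalSpace.Opens ℝ := ⟨Ioo (-1 : ℝ) 1, isOpen_Ioo⟩

/-- Lebesgue measure on `Ω`. -/
def μΩ : Measure ℝ := volume.restrict (Ioo (-1 : ℝ) 1)

/-- `g` is a weak derivative of `v` on `Ω`: both are locally integrable on `Ω` and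
`∫ v ψ' = - ∫ g ψ` for every smooth `ψ` with compact support in `Ω`. -/
def HasWeakDeriv (v g : ℝ → ℝ) : Prop :=
  LocallyIntegrableOn v (Ioo (-1 : ℝ) 1) volume ∧
  LocallyIntegrableOn g (Ioo (-1 : ℝ) 1) volume ∧
  ∀ ψ : TestFunction Ω ℝ ⊤, ∫ x, v x * deriv ψ x ∂μΩ = - ∫ x, g x * ψ x ∂μΩ

open Classical in
/-- The weak derivative of `v` on `Ω` (determined up to a null set), and `0` if there is none. -/
def weakDeriv (v : ℝ → ℝ) : ℝ → ℝ :=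
  if h : ∃ g, HasWeakDeriv v g then h.choose else 0

/-- Membership in the Sobolev space `W^{k,p}(Ω)`: the weak derivatives of order `0, …, k` exist
and lie in `L^p(Ω)`. -/
def MemW : ℕ → ENNReal → (ℝ → ℝ) → Prop
  | 0, p, v => MemLp v p μΩ
  | k + 1, p, v => MemLp v p μΩ ∧ ∃ g, HasWeakDeriv v g ∧ MemW k p g

/-- Membership in `H^1_0(Ω)`, the closure in `H^1(Ω)` of the smooth functions with compact
support in `Ω`. -/
def MemH10 (v : ℝ → ℝ) : Prop :=
  MemW 1 2 v ∧
  ∀ ε > 0, ∃ ψ : TestFunction Ω ℝ ⊤,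
    ∫ x, ((v x - ψ x) ^ 2 + (weakDeriv v x - deriv ψ x) ^ 2) ∂μΩ < ε

/-- `α = (r - q - 1) / 2`. -/
def alpha (r q : ℝ) : ℝ := (r - q - 1) / 2

/-- `β = α² + r`. -/
def beta (r q : ℝ) : ℝ := alpha r q ^ 2 + r

/-- The obstacle `φ(x) = e^{αx} max(e^x - 1, 0)`. -/
def obstacle (r q : ℝ) (x : ℝ) : ℝ :=
  Real.exp (alpha r q * x) * max (Real.exp x - 1) 0

/-- The convex set `𝒦 = {v ∈ H^1(Ω) | v - φ ∈ H^1_0(Ω), v ≥ φ a.e. in Ω}`. -/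
def Admissible (r q : ℝ) (v : ℝ → ℝ) : Prop :=
  MemW 1 2 v ∧ MemH10 (fun x => v x - obstacle r q x) ∧ ∀ᵐ x ∂μΩ, obstacle r q x ≤ v x

/-- The functional `J(v) = 1/2 ∫_Ω { |v - w|² / h + (v_x)² + β v² } dx`, where `w` is the
previous iterate. -/
def J (r q h : ℝ) (w v : ℝ → ℝ) : ℝ :=
  1 / 2 * ∫ x, ((v x - w x) ^ 2 / h + weakDeriv v x ^ 2 + beta r q * v x ^ 2) ∂μΩ

/-- `u 0, …, u ⌊T/h⌋` is the discrete Morse semiflow with time step `h`: `u 0 = φ`, and `u m`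
minimizes `J` with previous iterate `u (m - 1)` over `𝒦`. Each `u m` is taken to be the
representative continuous on `[-1, 1]` of its `H^1(Ω)` class, so that its pointwise values
make sense. -/
structure IsDMS (r q T h : ℝ) (u : ℕ → ℝ → ℝ) : Prop where
  init : EqOn (u 0) (obstacle r q) (Icc (-1) 1)
  cont : ∀ m ≤ ⌊T / h⌋₊, ContinuousOn (u m) (Icc (-1) 1)
  admissible : ∀ m, 1 ≤ m → m ≤ ⌊T / h⌋₊ → Admissible r q (u m)
  minimal : ∀ m, 1 ≤ m → m ≤ ⌊T / h⌋₊ →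
    ∀ v, Admissible r q v → J r q h (u (m - 1)) (u m) ≤ J r q h (u (m - 1)) v

end

end DMSBS

/-!
A minimizer `u` of `J` with previous iterate `w` solves an obstacle problem. Comparing `u` with
`u + ε ψ` for test functions `ψ` gives `u'' ≤ (u - w) / h + β u` in `Ω`, with equality where
`u > φ`. Instead of working with distributions, these relations are recorded as bounds on the
symmetric second differences `u (z + t) + u (z - t) - 2 u z` for small `t`
(`solvesObstacle_of_minimal`); in one dimension this pointwise form suffices for maximum
principles (`nonpos_of_secondDiff_pos`), for convexity (`convexOn_of_secondDiff_pos`) and for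
`W^{2,∞}` regularity (`memW_two_top_of_secondDiff`).

The difference quotient `d_m = (u_m - u_{m-1}) / h` is nonnegative. It vanishes on the contact set
of `u_m`, and elsewhere it is a subsolution of the backward Euler scheme for `d_t = d_xx - β d`
(with `d_0` replaced by `φ'' - β φ ≤ δ₀ + C`, the point mass coming from the kink of the
obstacle). Hence `d_m ≤ k_m + C`, where `k_m` is the kernel of the `m`-th power of the resolvent
`(1 - h d²/dx²)⁻¹` on the line (`IsDiscreteFlow.diff_le`). These kernels satisfy a three-term
recurrence, from which one reads off that they are nonnegative, unimodal and of mass at most `1`, with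
maximum at most `1 / (2 √(m h))`; in particular `k_m x ≤ 1 / (2 |x|)` uniformly in `m` and `h`.
So `d_m ≤ 1 / (2 √(m h)) + C` everywhere, and `d_m ≤ 1 / (2 x₄) + C` where `|x| ≥ x₄`. This is
stronger than the estimates with logarithms, as `|log h| ≥ 1` for `h < e⁻¹`.

The iterates are uniformly semiconvex (`IsDiscreteFlow.le_secondDiff`), because the obstacle is
and because `u_m'' ≥ 0` off the contact set. Together with `u_m'' ≤ d_m + β u_m` this bounds the
second derivative, and, as `u_m` lies above the obstacle and agrees with it at `±1`, it bounds the
slopes of `u_m`. Summing `h d_m` over time steps gives the estimates in time.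
-/

open Filter Topology ContDiff Convolution

namespace DMSBS

/-! ### Symmetric second differences -/

/-- The symmetric second difference `w (x + t) + w (x - t) - 2 w x`. -/
def secondDiff (w : ℝ → ℝ) (x t : ℝ) : ℝ := w (x + t) + w (x - t) - 2 * w x

theorem secondDiff_le_of_deriv {w w' : ℝ → ℝ} {x t c : ℝ} (ht : 0 ≤ t)
    (hw : ∀ y, |y - x| ≤ t → HasDerivAt w (w' y) y)
    (h : ∀ s, 0 ≤ s → s ≤ t → w' (x + s) - w' (x - s) ≤ 2 * c * s) :
    secondDiff w x t ≤ c * t ^ 2 := by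
  have hd : ∀ s ∈ Icc 0 t, HasDerivAt (fun s => secondDiff w x s - c * s ^ 2)
      (w' (x + s) - w' (x - s) - 2 * c * s) s := by
    intro s hs
    have h1 : HasDerivAt (fun s => w (x + s)) (w' (x + s)) s := by
      have := (hw (x + s) (by rw [add_sub_cancel_left, abs_of_nonneg hs.1]; exact hs.2))
      exact this.comp_const_add x s
    have h2 : HasDerivAt (fun s => w (x - s)) (-w' (x - s)) s := by
      have := (hw (x - s) (by rw [sub_sub_cancel_left, abs_neg, abs_of_nonneg hs.1]; exact hs.2))
      exact this.comp_const_sub x s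
    have h3 := ((h1.add h2).sub_const (2 * w x)).sub (((hasDerivAt_id s).pow 2).const_mul c)
    refine h3.congr_deriv ?_
    simp
    ring
  have hanti : AntitoneOn (fun s => secondDiff w x s - c * s ^ 2) (Icc 0 t) := by
    refine antitoneOn_of_deriv_nonpos (convex_Icc 0 t)
      (fun s hs => (hd s hs).continuousAt.continuousWithinAt)
      (fun s hs => (hd s (interior_subset hs)).differentiableAt.differentiableWithinAt) ?_
    intro s hs
    have hs' := interior_subset hs
    rw [(hd s hs').deriv]
    linarith [h s hs'.1 hs'.2]
  have := hanti (left_mem_Icc.2 ht) (right_mem_Icc.2 ht) ht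
  simp only [secondDiff, add_zero, sub_zero] at this
  simp only [secondDiff]
  linarith

theorem secondDiff_neg (w : ℝ → ℝ) (x t : ℝ) :
    secondDiff (fun y => -w y) x t = -secondDiff w x t := by
  simp only [secondDiff]; ring

theorem le_secondDiff_of_deriv {w w' : ℝ → ℝ} {x t c : ℝ} (ht : 0 ≤ t)
    (hw : ∀ y, |y - x| ≤ t → HasDerivAt w (w' y) y)
    (h : ∀ s, 0 ≤ s → s ≤ t → 2 * c * s ≤ w' (x + s) - w' (x - s)) :
    c * t ^ 2 ≤ secondDiff w x t := by
  have := secondDiff_le_of_deriv (w := fun y => -w y) (w' := fun y => -w' y) (c := -c) ht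
    (fun y hy => (hw y hy).neg) (fun s h0 h1 => by linarith [h s h0 h1])
  rw [secondDiff_neg] at this
  linarith

/-- If `w` has second derivative `L` at `x`, its second differences at `x` are at most `c t ^ 2`
for small `t`, for every `c > L`. -/
theorem eventually_secondDiff_le {w w' : ℝ → ℝ} {x L c : ℝ}
    (hw : ∀ᶠ y in 𝓝 x, HasDerivAt w (w' y) y) (hw' : HasDerivAt w' L x) (hc : L < c) :
    ∀ᶠ t in 𝓝[>] (0 : ℝ), secondDiff w x t ≤ c * t ^ 2 := by
  have h1 := (hasDerivAt_iff_isLittleO.1 hw').def (sub_pos.2 hc)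
  obtain ⟨δ, hδ, hball⟩ := Metric.eventually_nhds_iff.1 (hw.and h1)
  filter_upwards [Ioo_mem_nhdsGT hδ] with t ht
  refine secondDiff_le_of_deriv (w' := w') ht.1.le ?_ ?_
  · intro y hy
    exact (hball (by rw [Real.dist_eq]; linarith [ht.2])).1
  · intro s hs0 hst
    have ha := (hball (y := x + s) (by
      rw [Real.dist_eq, add_sub_cancel_left, abs_of_nonneg hs0]; linarith [ht.2])).2
    have hb := (hball (y := x - s) (by
      rw [Real.dist_eq, sub_sub_cancel_left, abs_neg, abs_of_nonneg hs0]; linarith [ht.2])).2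
    simp only [add_sub_cancel_left, sub_sub_cancel_left, smul_eq_mul, Real.norm_eq_abs, abs_neg,
      abs_of_nonneg hs0] at ha hb
    have ha' := (abs_le.1 ha).2
    have hb' := (abs_le.1 hb).1
    nlinarith

theorem eventually_le_secondDiff {w w' : ℝ → ℝ} {x L c : ℝ}
    (hw : ∀ᶠ y in 𝓝 x, HasDerivAt w (w' y) y) (hw' : HasDerivAt w' L x) (hc : c < L) :
    ∀ᶠ t in 𝓝[>] (0 : ℝ), c * t ^ 2 ≤ secondDiff w x t := by
  have := eventually_secondDiff_le (w := fun y => -w y) (w' := fun y => -w' y)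
    (hw.mono fun y hy => hy.neg) hw'.neg (neg_lt_neg hc)
  filter_upwards [this] with t ht
  rw [secondDiff_neg] at ht
  linarith

theorem eventually_mem_Icc_of_mem_Ioo {a b z : ℝ} (hz : z ∈ Ioo a b) :
    ∀ᶠ t in 𝓝[>] (0 : ℝ), 0 < t ∧ z + t ∈ Icc a b ∧ z - t ∈ Icc a b := by
  have hpos : 0 < min (z - a) (b - z) := lt_min (by linarith [hz.1]) (by linarith [hz.2])
  filter_upwards [Ioo_mem_nhdsGT hpos] with t ht
  have h1 := ht.2.trans_le (min_le_left _ _)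
  have h2 := ht.2.trans_le (min_le_right _ _)
  have h0 : 0 < t := ht.1
  exact ⟨h0, ⟨by linarith, by linarith⟩, ⟨by linarith, by linarith⟩⟩

/-- A maximum principle: a continuous function on `[a, b]` whose second differences are positive
along some sequence `t → 0` at every interior point where it is positive, and which is
nonpositive at the end points, is nonpositive. -/
theorem nonpos_of_secondDiff_pos {g : ℝ → ℝ} {a b : ℝ} (hab : a ≤ b)
    (hg : ContinuousOn g (Icc a b)) (ha : g a ≤ 0) (hb : g b ≤ 0)
    (h : ∀ z ∈ Ioo a b, 0 < g z → (∀ y ∈ Icc a b, g y ≤ g z) →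
      ∃ᶠ t in 𝓝[>] (0 : ℝ), 0 < secondDiff g z t) :
    ∀ x ∈ Icc a b, g x ≤ 0 := by
  obtain ⟨z, hz, hmax⟩ := isCompact_Icc.exists_isMaxOn (nonempty_Icc.2 hab) hg
  rw [isMaxOn_iff] at hmax
  intro x hx
  refine (hmax x hx).trans ?_
  by_contra! hpos
  have hza : z ≠ a := by rintro rfl; linarith
  have hzb : z ≠ b := by rintro rfl; linarith
  have hz' : z ∈ Ioo a b := ⟨lt_of_le_of_ne hz.1 hza.symm, lt_of_le_of_ne hz.2 hzb⟩
  obtain ⟨t, ht, -, h1, h2⟩ := ((h z hz' hpos hmax).and_eventually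
    (eventually_mem_Icc_of_mem_Ioo hz')).exists
  have e1 := hmax _ h1
  have e2 := hmax _ h2
  simp only [secondDiff] at ht
  linarith

theorem convexOn_of_secondDiff_pos {w : ℝ → ℝ} {a b : ℝ} (hw : ContinuousOn w (Icc a b))
    (h : ∀ z ∈ Ioo a b, ∃ᶠ t in 𝓝[>] (0 : ℝ), 0 < secondDiff w z t) :
    ConvexOn ℝ (Icc a b) w := by
  refine convexOn_of_slope_mono_adjacent (convex_Icc a b) ?_
  intro x y z hx hz hxy hyz
  have hxz : x < z := hxy.trans hyz
  set m := (w z - w x) / (z - x) with hm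
  have hmz : m * (z - x) = w z - w x := by rw [hm]; field_simp [sub_ne_zero.2 hxz.ne']
  have key := nonpos_of_secondDiff_pos (g := fun s => w s - w x - m * (s - x)) hxz.le
    (((hw.mono (Icc_subset_Icc hx.1 hz.2)).sub continuousOn_const).sub (by fun_prop))
    (by simp) (by linarith) (by
      intro s hs _ _
      refine (h s ⟨hx.1.trans_lt hs.1, hs.2.trans_le hz.2⟩).mono fun t ht => ?_
      simp only [secondDiff] at ht ⊢
      linarith) y ⟨hxy.le, hyz.le⟩
  have h1 : (w y - w x) / (y - x) ≤ m := by rw [div_le_iff₀ (by linarith)]; linarith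
  have h2 : m ≤ (w z - w y) / (z - y) := by rw [le_div_iff₀ (by linarith)]; linarith
  exact h1.trans h2

/-- If `w'' ≤ c` on the ball of radius `R` about `x` in the sense of distributions, then the second
differences of `w` with step `t < R` are at most `c t ^ 2`: mollify `w` and let the radius of the
mollifier tend to `0`. -/
theorem secondDiff_le_of_integral {w : ℝ → ℝ} (hw : Continuous w) {x t c R : ℝ} (ht : 0 ≤ t)
    (htR : t < R)
    (H : ∀ ψ : ℝ → ℝ, ContDiff ℝ ∞ ψ → (∀ y, 0 ≤ ψ y) → tsupport ψ ⊆ Metric.closedBall x R →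
      ∫ y, w y * deriv (deriv ψ) y ≤ c * ∫ y, ψ y) :
    secondDiff w x t ≤ c * t ^ 2 := by
  let ρ : ℕ → ContDiffBump (0 : ℝ) := fun n =>
    ⟨(R - t) / (n + 2), (R - t) / (n + 1), by have := sub_pos.2 htR; positivity,
      by have := sub_pos.2 htR; gcongr; norm_num⟩
  have hρ : Tendsto (fun n => (ρ n).rOut) atTop (𝓝 0) :=
    tendsto_const_div_atTop_nhds_zero_nat (R - t) |>.comp (tendsto_add_atTop_nat 1) |>.congr
      (fun n => by simp [ρ])
  let L := ContinuousLinearMap.lsmul ℝ ℝ (E := ℝ)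
  have hlim : ∀ y, Tendsto (fun n => (((ρ n).normed volume) ⋆[L, volume] w) y) atTop (𝓝 (w y)) :=
    fun y => ContDiffBump.convolution_tendsto_right_of_continuous hρ hw y
  have hlim2 : Tendsto (fun n => secondDiff (((ρ n).normed volume) ⋆[L, volume] w) x t) atTop
      (𝓝 (secondDiff w x t)) :=
    ((hlim _).add (hlim _)).sub ((hlim _).const_mul 2)
  refine le_of_tendsto' hlim2 fun n => ?_
  set φ := (ρ n).normed volume with hφ
  have hφs : ContDiff ℝ ∞ φ := (ρ n).contDiff_normed
  have hφ' : ContDiff ℝ ∞ (deriv φ) := (contDiff_infty_iff_deriv.1 hφs).2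
  have hφc : HasCompactSupport φ := (ρ n).hasCompactSupport_normed
  have hwl : LocallyIntegrable w volume := hw.locallyIntegrable
  have hd1 : ∀ y, HasDerivAt (φ ⋆[L, volume] w) ((deriv φ ⋆[L, volume] w) y) y := fun y =>
    hφc.hasDerivAt_convolution_left L (hφs.of_le (by exact_mod_cast le_top)) hwl y
  have hd2 : ∀ y, HasDerivAt (deriv φ ⋆[L, volume] w)
      ((deriv (deriv φ) ⋆[L, volume] w) y) y := fun y =>
    hφc.deriv.hasDerivAt_convolution_left L (hφ'.of_le (by exact_mod_cast le_top)) hwl y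
  have hbound : ∀ y, |y - x| ≤ t → (deriv (deriv φ) ⋆[L, volume] w) y ≤ c := by
    intro y hy
    have hψ1 : deriv (fun s => φ (y - s)) = fun s => -deriv φ (y - s) := by
      funext s; exact deriv_comp_const_sub ..
    have hψ2 : deriv (deriv (fun s => φ (y - s))) = fun s => deriv (deriv φ) (y - s) := by
      rw [hψ1]; funext s
      rw [deriv.fun_neg, deriv_comp_const_sub, neg_neg]
    have := H (fun s => φ (y - s)) (hφs.comp (contDiff_const.sub contDiff_id))
      (fun s => (ρ n).nonneg_normed _) ?_
    · rw [hψ2] at this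
      rw [integral_sub_left_eq_self φ volume y, (ρ n).integral_normed, mul_one] at this
      rw [convolution_eq_swap]
      refine le_trans (le_of_eq ?_) this
      refine integral_congr_ae (Eventually.of_forall fun s => ?_)
      simp [L, mul_comm]
    · refine closure_minimal ?_ Metric.isClosed_closedBall
      intro s hs
      have : y - s ∈ Function.support φ := hs
      rw [hφ, (ρ n).support_normed_eq, mem_ball_zero_iff, Real.norm_eq_abs] at this
      have hr : (ρ n).rOut ≤ R - t := by
        simp only [ρ]
        exact div_le_self (sub_pos.2 htR).le (by linarith [n.cast_nonneg (α := ℝ)])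
      rw [Metric.mem_closedBall, Real.dist_eq]
      have h3 : s - x = (y - x) - (y - s) := by ring
      rw [h3]
      linarith [abs_sub (y - x) (y - s)]
  have hmono : ∀ s, 0 ≤ s → s ≤ t →
      (deriv φ ⋆[L, volume] w) (x + s) - (deriv φ ⋆[L, volume] w) (x - s) ≤ 2 * c * s := by
    intro s hs0 hst
    have := (convex_Icc (x - s) (x + s)).image_sub_le_mul_sub_of_deriv_le
      (f := (deriv φ ⋆[L, volume] w)) (C := c)
      (fun y _ => (hd2 y).continuousAt.continuousWithinAt)
      (fun y _ => (hd2 y).differentiableAt.differentiableWithinAt)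
      (fun y hy => by
        rw [(hd2 y).deriv]
        have := interior_subset hy
        exact hbound y (abs_le.2 ⟨by linarith [this.1], by linarith [this.2]⟩))
      (x - s) ⟨le_rfl, by linarith⟩ (x + s) ⟨by linarith, le_rfl⟩ (by linarith)
    linarith
  exact secondDiff_le_of_deriv ht (fun y _ => hd1 y) hmono

/-! ### Weak derivatives on `Ω` -/

instance isFiniteMeasure_μΩ : IsFiniteMeasure μΩ := by
  unfold μΩ; infer_instance

theorem integral_μΩ_eq_integral {f : ℝ → ℝ} (hf : ∀ x, x ∉ Ioo (-1 : ℝ) 1 → f x = 0) :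
    ∫ x, f x ∂μΩ = ∫ x, f x :=
  setIntegral_eq_integral_of_forall_compl_eq_zero hf

theorem integrable_restrict_Ω {f : ℝ → ℝ} (hf : Integrable f volume) : Integrable f μΩ :=
  hf.restrict

theorem integrable_μΩ_of_continuousOn {f : ℝ → ℝ} (hf : ContinuousOn f (Icc (-1) 1)) :
    Integrable f μΩ :=
  (hf.integrableOn_compact isCompact_Icc).mono_set Ioo_subset_Icc_self

theorem locallyIntegrableOn_of_continuousOn {f : ℝ → ℝ} (hf : ContinuousOn f (Icc (-1) 1)) :
    LocallyIntegrableOn f (Ioo (-1 : ℝ) 1) volume :=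
  ((hf.integrableOn_compact isCompact_Icc).mono_set Ioo_subset_Icc_self).locallyIntegrableOn

theorem memLp_μΩ_of_continuousOn {f : ℝ → ℝ} {p : ENNReal} (hf : ContinuousOn f (Icc (-1) 1)) :
    MemLp f p μΩ := by
  obtain ⟨C, hC⟩ := isCompact_Icc.exists_bound_of_continuousOn hf
  refine MemLp.of_bound (integrable_μΩ_of_continuousOn hf).aestronglyMeasurable C ?_
  unfold μΩ
  rw [ae_restrict_iff' measurableSet_Ioo]
  exact Eventually.of_forall fun x hx => hC x (Ioo_subset_Icc_self hx)

section TestFunctions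

variable (ψ : TestFunction Ω ℝ ⊤)

theorem test_contDiff : ContDiff ℝ ∞ ψ := ψ.contDiff

theorem test_eq_zero {x : ℝ} (hx : x ∉ Ioo (-1 : ℝ) 1) : ψ x = 0 :=
  image_eq_zero_of_notMem_tsupport fun h => hx (ψ.tsupport_subset h)

/-- The derivative of a test function, as a test function. -/
noncomputable def testDeriv : TestFunction Ω ℝ ⊤ :=
  ⟨deriv ψ, (contDiff_infty_iff_deriv.1 (test_contDiff ψ)).2, ψ.hasCompactSupport.deriv,
    (closure_mono (support_deriv_subset (f := ψ)) |>.trans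
      (by rw [closure_eq_iff_isClosed.2 (isClosed_tsupport ψ)])).trans ψ.tsupport_subset⟩

theorem testDeriv_apply (x : ℝ) : testDeriv ψ x = deriv ψ x := rfl

theorem test_hasDerivAt (x : ℝ) : HasDerivAt ψ (deriv ψ x) x :=
  ((contDiff_infty_iff_deriv.1 (test_contDiff ψ)).1 x).hasDerivAt

theorem test_memLp (p : ENNReal) : MemLp ψ p μΩ :=
  memLp_μΩ_of_continuousOn ψ.continuous.continuousOn

/-- The test function `χ + ε ψ`. -/
noncomputable def testAddSmul (χ : TestFunction Ω ℝ ⊤) (ε : ℝ) : TestFunction Ω ℝ ⊤ := χ + ε • ψ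

theorem testAddSmul_apply (χ : TestFunction Ω ℝ ⊤) (ε x : ℝ) :
    testAddSmul ψ χ ε x = χ x + ε * ψ x := rfl

theorem deriv_testAddSmul (χ : TestFunction Ω ℝ ⊤) (ε x : ℝ) :
    deriv (testAddSmul ψ χ ε) x = deriv χ x + ε * deriv ψ x :=
  ((test_hasDerivAt χ x).add ((test_hasDerivAt ψ x).const_mul ε)).deriv

theorem integrable_mul_test {g : ℝ → ℝ} (hg : LocallyIntegrableOn g (Ioo (-1 : ℝ) 1) volume) :
    Integrable (fun x => g x * ψ x) volume := by
  have h1 : IntegrableOn g (tsupport ψ) volume :=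
    hg.integrableOn_compact_subset ψ.tsupport_subset ψ.hasCompactSupport
  have h2 := h1.mul_continuousOn ψ.continuous.continuousOn ψ.hasCompactSupport
  refine (integrableOn_iff_integrable_of_support_subset ?_).1 h2
  exact (Function.support_mul_subset_right _ _).trans (subset_tsupport ψ)

theorem integral_mul_test (g : ℝ → ℝ) : ∫ x, g x * ψ x ∂μΩ = ∫ x, g x * ψ x :=
  integral_μΩ_eq_integral fun x hx => by rw [test_eq_zero ψ hx, mul_zero]

end TestFunctions

theorem HasWeakDeriv.ae_eq {v g g' : ℝ → ℝ} (h : HasWeakDeriv v g) (h' : HasWeakDeriv v g') :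
    g =ᵐ[μΩ] g' := by
  have key := isOpen_Ioo.ae_eq_zero_of_integral_contDiff_smul_eq_zero (U := Ioo (-1 : ℝ) 1)
    (h.2.1.sub h'.2.1) (μ := volume) fun ψ hψ hc hs => ?_
  · unfold μΩ
    rw [Filter.EventuallyEq, ae_restrict_iff' measurableSet_Ioo]
    filter_upwards [key] with x hx hxm
    exact sub_eq_zero.1 (hx hxm)
  · let Ψ : TestFunction Ω ℝ ⊤ := ⟨ψ, hψ, hc, hs⟩
    have e := (h.2.2 Ψ).symm.trans (h'.2.2 Ψ)
    rw [integral_mul_test, integral_mul_test] at e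
    have e2 := integral_sub (integrable_mul_test Ψ h.2.1) (integrable_mul_test Ψ h'.2.1)
    rw [neg_inj.1 e, sub_self] at e2
    rw [← e2]
    refine integral_congr_ae (Eventually.of_forall fun x => ?_)
    change ψ x * (g x - g' x) = g x * ψ x - g' x * ψ x
    ring

theorem HasWeakDeriv.hasWeakDeriv_weakDeriv {v g : ℝ → ℝ} (h : HasWeakDeriv v g) :
    HasWeakDeriv v (weakDeriv v) := by
  have hex : ∃ g, HasWeakDeriv v g := ⟨g, h⟩
  unfold weakDeriv
  rw [dif_pos hex]
  exact hex.choose_spec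

theorem HasWeakDeriv.weakDeriv_ae_eq {v g : ℝ → ℝ} (h : HasWeakDeriv v g) :
    weakDeriv v =ᵐ[μΩ] g :=
  h.hasWeakDeriv_weakDeriv.ae_eq h

theorem HasWeakDeriv.congr_left {v v' g : ℝ → ℝ} (h : HasWeakDeriv v g) (hv : v =ᵐ[μΩ] v')
    (hl : LocallyIntegrableOn v' (Ioo (-1 : ℝ) 1) volume) : HasWeakDeriv v' g := by
  refine ⟨hl, h.2.1, fun ψ => ?_⟩
  rw [← h.2.2 ψ]
  exact integral_congr_ae (hv.mono fun x hx => by simp only [hx])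

theorem hasWeakDeriv_test (ψ : TestFunction Ω ℝ ⊤) : HasWeakDeriv ψ (deriv ψ) := by
  have hc : Continuous (deriv ψ) := (testDeriv ψ).continuous
  refine ⟨locallyIntegrableOn_of_continuousOn ψ.continuous.continuousOn,
    locallyIntegrableOn_of_continuousOn hc.continuousOn, fun χ => ?_⟩
  refine (integral_mul_test (testDeriv χ) ψ).trans ?_
  rw [integral_mul_test χ]
  have hl : ∀ θ : TestFunction Ω ℝ ⊤, LocallyIntegrableOn θ (Ioo (-1 : ℝ) 1) volume :=
    fun θ => locallyIntegrableOn_of_continuousOn θ.continuous.continuousOn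
  exact integral_mul_deriv_eq_deriv_mul_of_integrable (fun x _ => test_hasDerivAt ψ x)
    (fun x _ => test_hasDerivAt χ x)
    (integrable_mul_test (testDeriv χ) (hl ψ)) (integrable_mul_test χ (hl (testDeriv ψ)))
    (integrable_mul_test χ (hl ψ))

theorem HasWeakDeriv.add_smul {v g : ℝ → ℝ} (h : HasWeakDeriv v g) (ψ : TestFunction Ω ℝ ⊤)
    (ε : ℝ) : HasWeakDeriv (fun x => v x + ε * ψ x) (fun x => g x + ε * deriv ψ x) := by
  have hψ := hasWeakDeriv_test ψ
  refine ⟨h.1.add (hψ.1.smul ε), h.2.1.add (hψ.2.1.smul ε), fun χ => ?_⟩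
  have e1 := h.2.2 χ
  have e2 := hψ.2.2 χ
  have i1 := (integrable_restrict_Ω <| integrable_mul_test (testDeriv χ) h.1)
  have i2 := (integrable_restrict_Ω <| integrable_mul_test (testDeriv χ) hψ.1)
  have i3 := (integrable_restrict_Ω <| integrable_mul_test χ h.2.1)
  have i4 := (integrable_restrict_Ω <| integrable_mul_test χ hψ.2.1)
  calc ∫ x, (v x + ε * ψ x) * deriv χ x ∂μΩ
      = ∫ x, v x * deriv χ x + ε * (ψ x * deriv χ x) ∂μΩ := by
        congr 1; funext x; ring
    _ = (∫ x, v x * deriv χ x ∂μΩ) + ε * ∫ x, ψ x * deriv χ x ∂μΩ := by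
        exact (integral_add i1 (i2.const_mul ε)).trans (by rw [integral_const_mul]; rfl)
    _ = -((∫ x, g x * χ x ∂μΩ) + ε * ∫ x, deriv ψ x * χ x ∂μΩ) := by rw [e1, e2]; ring
    _ = -∫ x, g x * χ x + ε * (deriv ψ x * χ x) ∂μΩ := by
        rw [integral_add i3 (i4.const_mul ε), integral_const_mul]
    _ = -∫ x, (g x + ε * deriv ψ x) * χ x ∂μΩ := by
        congr 2; funext x; ring

theorem MemW.hasWeakDeriv {v : ℝ → ℝ} {k : ℕ} {p : ENNReal} (h : MemW (k + 1) p v) :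
    HasWeakDeriv v (weakDeriv v) := by
  obtain ⟨g, hg, -⟩ := h.2
  exact hg.hasWeakDeriv_weakDeriv

theorem MemW.memLp_weakDeriv {v : ℝ → ℝ} {p : ENNReal} (h : MemW 1 p v) :
    MemLp (weakDeriv v) p μΩ := by
  obtain ⟨g, hg, hgp⟩ := h.2
  exact (memLp_congr_ae hg.weakDeriv_ae_eq).2 hgp

theorem MemW.add_smul {v : ℝ → ℝ} (h : MemW 1 2 v) (ψ : TestFunction Ω ℝ ⊤) (ε : ℝ) :
    MemW 1 2 (fun x => v x + ε * ψ x) :=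
  ⟨h.1.add ((test_memLp ψ 2).const_mul ε), _, h.hasWeakDeriv.add_smul ψ ε,
    h.memLp_weakDeriv.add ((test_memLp (testDeriv ψ) 2).const_mul ε)⟩

theorem MemH10.add_smul {v : ℝ → ℝ} (h : MemH10 v) (ψ : TestFunction Ω ℝ ⊤) (ε : ℝ) :
    MemH10 (fun x => v x + ε * ψ x) := by
  refine ⟨h.1.add_smul ψ ε, fun δ hδ => ?_⟩
  obtain ⟨χ, hχ⟩ := h.2 δ hδ
  refine ⟨testAddSmul ψ χ ε, lt_of_eq_of_lt (integral_congr_ae ?_) hχ⟩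
  filter_upwards [(h.1.hasWeakDeriv.add_smul ψ ε).weakDeriv_ae_eq] with x hx
  rw [hx, testAddSmul_apply, deriv_testAddSmul]
  ring

/-! ### Boundary values of functions in `H^1_0(Ω)` -/

/-- A test function is small near an end point `e` of `Ω`, in terms of the `L^2` norm of its
derivative; this is `|ψ'| ≤ (l + ψ' ^ 2 / l) / 2`, integrated. -/
theorem abs_test_le (ψ : TestFunction Ω ℝ ⊤) {e x l : ℝ} (he : e = -1 ∨ e = 1)
    (hl : 0 < l) : |ψ x| ≤ l / 2 * |x - e| + 1 / (2 * l) * ∫ y, deriv ψ y ^ 2 ∂μΩ := by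
  have hψe : ψ e = 0 := test_eq_zero ψ (by rcases he with rfl | rfl <;> simp)
  have hc : Continuous (deriv ψ) := (testDeriv ψ).continuous
  have hint : Integrable (fun y => deriv ψ y ^ 2) volume := by
    have := integrable_mul_test (testDeriv ψ)
      (locallyIntegrableOn_of_continuousOn (testDeriv ψ).continuous.continuousOn)
    refine this.congr (Eventually.of_forall fun y => ?_)
    simp only [testDeriv_apply]; ring
  have hΩ : ∫ y, deriv ψ y ^ 2 ∂μΩ = ∫ y, deriv ψ y ^ 2 :=
    integral_μΩ_eq_integral fun y hy => by
      rw [← testDeriv_apply, test_eq_zero (testDeriv ψ) hy]; simp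
  have h1 : ∫ y in e..x, deriv ψ y = ψ x := by
    rw [intervalIntegral.integral_eq_sub_of_hasDerivAt (fun y _ => test_hasDerivAt ψ y)
      (hc.intervalIntegrable _ _), hψe, sub_zero]
  have hfin : volume (uIoc e x) ≠ ⊤ := by rw [Real.volume_uIoc]; exact ENNReal.ofReal_ne_top
  have hi2 : IntegrableOn (fun y => l / 2 + 1 / (2 * l) * deriv ψ y ^ 2) (uIoc e x) volume :=
    (integrableOn_const hfin).add (hint.integrableOn.const_mul _)
  calc |ψ x| = ‖∫ y in e..x, deriv ψ y‖ := by rw [h1, Real.norm_eq_abs]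
    _ ≤ ∫ y in uIoc e x, ‖deriv ψ y‖ := intervalIntegral.norm_integral_le_integral_norm_uIoc
    _ ≤ ∫ y in uIoc e x, (l / 2 + 1 / (2 * l) * deriv ψ y ^ 2) := by
        refine setIntegral_mono ((hc.intervalIntegrable e x).def'.norm) hi2 fun y => ?_
        have h2 : 0 ≤ (l - |deriv ψ y|) ^ 2 / (2 * l) := by positivity
        have h3 : (l - |deriv ψ y|) ^ 2 / (2 * l)
            = l / 2 + 1 / (2 * l) * deriv ψ y ^ 2 - |deriv ψ y| := by
          rw [← sq_abs (deriv ψ y)]; field_simp; ring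
        rw [Real.norm_eq_abs]
        linarith
    _ = l / 2 * |x - e| + 1 / (2 * l) * ∫ y in uIoc e x, deriv ψ y ^ 2 := by
        rw [integral_add (integrable_const_iff.2 (Or.inr ⟨by simp⟩))
          (hint.integrableOn.const_mul _), integral_const_mul, setIntegral_const, Measure.real, Real.volume_uIoc,
          ENNReal.toReal_ofReal (abs_nonneg _), smul_eq_mul]
        ring
    _ ≤ l / 2 * |x - e| + 1 / (2 * l) * ∫ y, deriv ψ y ^ 2 ∂μΩ := by
        have h2 : ∫ y in uIoc e x, deriv ψ y ^ 2 ≤ ∫ y, deriv ψ y ^ 2 :=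
          setIntegral_le_integral hint (Eventually.of_forall fun y => sq_nonneg _)
        rw [hΩ]
        gcongr

/-- A function in `H^1_0(Ω)` that is continuous on `[-1, 1]` vanishes at the end points: otherwise
it stays away from `0` near an end point `e`, where all test functions with a fixed bound on the
`L^2` norm of the derivative are small. -/
theorem MemH10.eq_zero {w : ℝ → ℝ} (h : MemH10 w) (hw : ContinuousOn w (Icc (-1) 1)) {e : ℝ}
    (he : e = -1 ∨ e = 1) : w e = 0 := by
  by_contra hne
  set a := |w e| with ha
  have ha0 : 0 < a := abs_pos.2 hne
  have hg : MemLp (weakDeriv w) 2 μΩ := h.1.memLp_weakDeriv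
  set g := weakDeriv w
  set P := 2 * (∫ y, g y ^ 2 ∂μΩ) + 2 with hP
  have hG : 0 ≤ ∫ y, g y ^ 2 ∂μΩ := integral_nonneg fun y => sq_nonneg _
  have hP0 : 0 < P := by positivity
  -- with this `l`, the second term of `abs_test_le` is at most `a / 8`
  set l := 4 * P / a with hl
  have hl0 : 0 < l := by positivity
  have hemem : e ∈ Icc (-1 : ℝ) 1 := by rcases he with rfl | rfl <;> simp
  obtain ⟨s0, hs0, hws⟩ := Metric.continuousWithinAt_iff.1 (hw e hemem) (a / 4) (by positivity)
  set s := min (min s0 1) (a / (4 * l)) with hs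
  have hspos : 0 < s := by positivity
  have hss0 : s ≤ s0 := (min_le_left _ _).trans (min_le_left _ _)
  have hs1 : s ≤ 1 := (min_le_left _ _).trans (min_le_right _ _)
  have hsl : l / 2 * s ≤ a / 8 := by
    have : s ≤ a / (4 * l) := min_le_right _ _
    calc l / 2 * s ≤ l / 2 * (a / (4 * l)) := by gcongr
      _ = a / 8 := by field_simp; ring
  set S := Ioo (e - s) (e + s) ∩ Ioo (-1 : ℝ) 1 with hS
  have hSo : IsOpen S := isOpen_Ioo.inter isOpen_Ioo
  have hSne : S.Nonempty := by
    rcases he with rfl | rfl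
    · exact ⟨-1 + s / 2, ⟨by linarith, by linarith⟩, by linarith, by linarith⟩
    · exact ⟨1 - s / 2, ⟨by linarith, by linarith⟩, by linarith, by linarith⟩
  have hSfin : volume S ≠ ⊤ :=
    ((measure_mono inter_subset_right).trans_lt (by simp [Real.volume_Ioo])).ne
  have hSpos : 0 < volume.real S := ENNReal.toReal_pos (hSo.measure_pos _ hSne).ne' hSfin
  obtain ⟨ψ, hψ⟩ := h.2 (min 1 (a ^ 2 / 4 * volume.real S)) (by positivity)
  have hψ2 : MemLp ψ 2 μΩ := test_memLp ψ 2
  have hψ2' : MemLp (deriv ψ) 2 μΩ := test_memLp (testDeriv ψ) 2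
  have hw2 : MemLp w 2 μΩ := memLp_μΩ_of_continuousOn hw
  have i1 : Integrable (fun y => (w y - ψ y) ^ 2) μΩ := (hw2.sub hψ2).integrable_sq
  have i2 : Integrable (fun y => (g y - deriv ψ y) ^ 2) μΩ := (hg.sub hψ2').integrable_sq
  rw [integral_add i1 i2] at hψ
  have n1 : 0 ≤ ∫ y, (w y - ψ y) ^ 2 ∂μΩ := integral_nonneg fun y => sq_nonneg _
  have n2 : 0 ≤ ∫ y, (g y - deriv ψ y) ^ 2 ∂μΩ := integral_nonneg fun y => sq_nonneg _
  have hlt1 := hψ.trans_le (min_le_left _ _)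
  have hlt2 := hψ.trans_le (min_le_right _ _)
  have hPψ : ∫ y, deriv ψ y ^ 2 ∂μΩ ≤ P := by
    calc ∫ y, deriv ψ y ^ 2 ∂μΩ ≤ ∫ y, (2 * g y ^ 2 + 2 * (g y - deriv ψ y) ^ 2) ∂μΩ := by
          refine integral_mono hψ2'.integrable_sq
            ((hg.integrable_sq.const_mul 2).add (i2.const_mul 2)) fun y => ?_
          simp only
          nlinarith [sq_nonneg (2 * g y - deriv ψ y)]
      _ ≤ P := by
          rw [integral_add (hg.integrable_sq.const_mul 2) (i2.const_mul 2), integral_const_mul,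
            integral_const_mul]
          linarith
  have hlow : ∀ x ∈ S, a ^ 2 / 4 ≤ (w x - ψ x) ^ 2 := by
    intro x hx
    have hxe : |x - e| ≤ s := abs_le.2 ⟨by linarith [hx.1.1], by linarith [hx.1.2]⟩
    have hxe' : dist x e < s0 := by
      rw [Real.dist_eq]
      exact (abs_lt.2 ⟨by linarith [hx.1.1], by linarith [hx.1.2]⟩ : |x - e| < s).trans_le hss0
    have h1 := hws (Ioo_subset_Icc_self hx.2) hxe'
    rw [Real.dist_eq] at h1
    have h2 : |ψ x| ≤ a / 4 := by
      refine (abs_test_le ψ he hl0).trans ?_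
      have h3 : l / 2 * |x - e| ≤ a / 8 := le_trans (by gcongr) hsl
      have h4 : 1 / (2 * l) * ∫ y, deriv ψ y ^ 2 ∂μΩ ≤ 1 / (2 * l) * P := by gcongr
      have h5 : 1 / (2 * l) * P = a / 8 := by rw [hl]; field_simp; ring
      linarith
    have h6 : a / 2 ≤ |w x - ψ x| := by
      have : w e = (w x - ψ x) - (w x - w e) + ψ x := by ring
      have h7 : a ≤ |w x - ψ x| + |w x - w e| + |ψ x| := by
        rw [ha]
        nth_rewrite 1 [this]
        exact (abs_add_le _ _).trans (by gcongr; exact abs_sub _ _)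
      linarith
    rw [← sq_abs (w x - ψ x)]
    nlinarith
  have hSΩ : μΩ.restrict S = volume.restrict S := by
    unfold μΩ
    rw [Measure.restrict_restrict hSo.measurableSet, inter_assoc, inter_self]
  have hfinal : a ^ 2 / 4 * volume.real S ≤ ∫ y, (w y - ψ y) ^ 2 ∂μΩ := by
    refine le_trans ?_ (setIntegral_le_integral (s := S) i1
      (Eventually.of_forall fun y => sq_nonneg _))
    have i3 : IntegrableOn (fun y => (w y - ψ y) ^ 2) S μΩ := i1.integrableOn
    unfold IntegrableOn at i3
    rw [hSΩ] at i3 ⊢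
    have := setIntegral_mono_on (integrableOn_const hSfin (C := a ^ 2 / 4)) i3
      hSo.measurableSet hlow
    rw [setIntegral_const, smul_eq_mul] at this
    linarith
  linarith

/-! ### The variational inequality -/

theorem Admissible.add_smul {r q : ℝ} {v : ℝ → ℝ} (h : Admissible r q v)
    (ψ : TestFunction Ω ℝ ⊤) (ε : ℝ) (hle : ∀ᵐ x ∂μΩ, obstacle r q x ≤ v x + ε * ψ x) :
    Admissible r q (fun x => v x + ε * ψ x) := by
  refine ⟨h.1.add_smul ψ ε, ?_, hle⟩
  have := h.2.1.add_smul ψ ε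
  refine (congrArg MemH10 ?_).mp this
  funext x; ring

/-- The first variation of `J` at a minimizer `u` in an admissible direction `ψ`, integrated by
parts so that no derivative of `u` appears. -/
theorem first_variation_nonneg {r q h : ℝ} {w u : ℝ → ℝ}
    (hu : ContinuousOn u (Icc (-1) 1)) (hw : ContinuousOn w (Icc (-1) 1))
    (hadm : Admissible r q u) (hmin : ∀ v, Admissible r q v → J r q h w u ≤ J r q h w v)
    (ψ : TestFunction Ω ℝ ⊤)
    (hψ : ∀ᶠ ε in 𝓝[>] (0 : ℝ), ∀ᵐ x ∂μΩ, obstacle r q x ≤ u x + ε * ψ x) :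
    ∫ x, u x * deriv (deriv ψ) x ≤ ∫ x, ((u x - w x) / h + beta r q * u x) * ψ x := by
  set β := beta r q
  set g := weakDeriv u with hg
  have hg2 : MemLp g 2 μΩ := hadm.1.memLp_weakDeriv
  have hψc : Continuous ψ := ψ.continuous
  have hψ'c : Continuous (deriv ψ) := (testDeriv ψ).continuous
  have hψ'2 : MemLp (deriv ψ) 2 μΩ := test_memLp (testDeriv ψ) 2
  set F : ℝ → ℝ := fun x => (u x - w x) / h + β * u x with hF
  have hFc : ContinuousOn F (Icc (-1) 1) := ((hu.sub hw).div_const h).add (hu.const_mul β)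
  have iA : Integrable (fun x => (u x - w x) ^ 2 / h + g x ^ 2 + β * u x ^ 2) μΩ :=
    ((integrable_μΩ_of_continuousOn (((hu.sub hw).pow 2).div_const h)).add
      hg2.integrable_sq).add (integrable_μΩ_of_continuousOn ((hu.pow 2).const_mul β))
  have iFψ : Integrable (fun x => F x * ψ x) μΩ :=
    integrable_μΩ_of_continuousOn (hFc.mul hψc.continuousOn)
  have igψ : Integrable (fun x => g x * deriv ψ x) μΩ := hg2.integrable_mul hψ'2
  set B : ℝ → ℝ := fun x => F x * ψ x + g x * deriv ψ x with hB
  have iB : Integrable B μΩ := iFψ.add igψ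
  set C : ℝ → ℝ := fun x => ψ x ^ 2 / h + deriv ψ x ^ 2 + β * ψ x ^ 2 with hC
  have iC : Integrable C μΩ :=
    integrable_μΩ_of_continuousOn (by fun_prop)
  -- `J` is quadratic, so its expansion in `ε` is exact
  have hJ : ∀ ε, J r q h w (fun x => u x + ε * ψ x)
      = J r q h w u + ε * (∫ x, B x ∂μΩ) + ε ^ 2 / 2 * ∫ x, C x ∂μΩ := by
    intro ε
    have e1 : ∫ x, ((u x + ε * ψ x - w x) ^ 2 / h
          + weakDeriv (fun x => u x + ε * ψ x) x ^ 2 + β * (u x + ε * ψ x) ^ 2) ∂μΩ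
        = ∫ x, (((u x - w x) ^ 2 / h + g x ^ 2 + β * u x ^ 2) + 2 * ε * B x) + ε ^ 2 * C x ∂μΩ := by
      refine integral_congr_ae ?_
      filter_upwards [(hadm.1.hasWeakDeriv.add_smul ψ ε).weakDeriv_ae_eq] with x hx
      rw [hx]
      simp only [hB, hC, hF]
      ring
    have iAB : Integrable (fun x => ((u x - w x) ^ 2 / h + g x ^ 2 + β * u x ^ 2)
        + 2 * ε * B x) μΩ := iA.add (iB.const_mul _)
    rw [integral_add iAB (iC.const_mul _), integral_add iA (iB.const_mul _),
      integral_const_mul, integral_const_mul] at e1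
    unfold J
    rw [e1]
    ring
  have hpos : 0 ≤ ∫ x, B x ∂μΩ := by
    have hlim : Tendsto (fun ε : ℝ => (∫ x, B x ∂μΩ) + ε / 2 * ∫ x, C x ∂μΩ) (𝓝[>] 0)
        (𝓝 ((∫ x, B x ∂μΩ) + 0 / 2 * ∫ x, C x ∂μΩ)) := by
      refine Tendsto.mono_left (Continuous.tendsto ?_ 0) nhdsWithin_le_nhds
      fun_prop
    rw [zero_div, zero_mul, add_zero] at hlim
    refine ge_of_tendsto hlim ?_
    filter_upwards [hψ, self_mem_nhdsWithin] with ε hε hε0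
    have hε0' : 0 < ε := hε0
    have h1 := hmin _ (hadm.add_smul ψ ε hε)
    rw [hJ ε] at h1
    have h2 : 0 ≤ ε * ((∫ x, B x ∂μΩ) + ε / 2 * ∫ x, C x ∂μΩ) := by linarith
    exact nonneg_of_mul_nonneg_right h2 hε0'
  rw [hB, integral_add iFψ igψ, integral_mul_test ψ F] at hpos
  have e2 := hadm.1.hasWeakDeriv.2.2 (testDeriv ψ)
  have e3 : ∫ x, u x * deriv (testDeriv ψ) x ∂μΩ = ∫ x, u x * deriv (deriv ψ) x :=
    integral_mul_test (testDeriv (testDeriv ψ)) u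
  have e4 : ∫ x, g x * testDeriv ψ x ∂μΩ = ∫ x, g x * deriv ψ x ∂μΩ := rfl
  rw [e3, e4] at e2
  linarith

/-- `u` satisfies the obstacle problem with right-hand side `F` in the pointwise sense used here:
`u'' ≤ F` everywhere in `Ω`, and `u'' ≥ F` where `u` is above the obstacle `φ`, both inequalities
being expressed by symmetric second differences. -/
structure SolvesObstacle (φ u F : ℝ → ℝ) : Prop where
  cont : ContinuousOn u (Icc (-1) 1)
  ge : ∀ x ∈ Icc (-1 : ℝ) 1, φ x ≤ u x
  left : u (-1) = φ (-1)
  right : u 1 = φ 1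
  super : ∀ z ∈ Ioo (-1 : ℝ) 1, ∀ c, F z < c →
    ∀ᶠ t in 𝓝[>] (0 : ℝ), secondDiff u z t ≤ c * t ^ 2
  sub : ∀ z ∈ Ioo (-1 : ℝ) 1, φ z < u z → ∀ c, c < F z →
    ∀ᶠ t in 𝓝[>] (0 : ℝ), c * t ^ 2 ≤ secondDiff u z t

theorem continuous_obstacle (r q : ℝ) : Continuous (obstacle r q) := by
  unfold obstacle; fun_prop

theorem ae_μΩ {p : ℝ → Prop} (h : ∀ x ∈ Ioo (-1 : ℝ) 1, p x) : ∀ᵐ x ∂μΩ, p x := by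
  unfold μΩ
  rw [ae_restrict_iff' measurableSet_Ioo]
  exact Eventually.of_forall h

theorem le_of_ae_le {f g : ℝ → ℝ} (hf : ContinuousOn f (Icc (-1) 1))
    (hg : ContinuousOn g (Icc (-1) 1)) (h : ∀ᵐ x ∂μΩ, f x ≤ g x) :
    ∀ x ∈ Icc (-1 : ℝ) 1, f x ≤ g x := by
  have hsup : (fun x => max (f x) (g x)) =ᵐ[volume.restrict (Icc (-1 : ℝ) 1)] g := by
    rw [← restrict_Ioo_eq_restrict_Icc]
    filter_upwards [h] with x hx using max_eq_right hx
  have := Measure.eqOn_Icc_of_ae_eq volume (by norm_num : (-1 : ℝ) ≠ 1) hsup (hf.sup hg) hg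
  intro x hx
  rw [← this hx]
  exact le_max_left _ _

/-- A minimizer of `J` solves the obstacle problem `u'' = (u - w) / h + β u`. -/
theorem solvesObstacle_of_minimal {r q h : ℝ} {w u : ℝ → ℝ}
    (hu : ContinuousOn u (Icc (-1) 1)) (hw : ContinuousOn w (Icc (-1) 1))
    (hadm : Admissible r q u) (hmin : ∀ v, Admissible r q v → J r q h w u ≤ J r q h w v) :
    SolvesObstacle (obstacle r q) u (fun x => (u x - w x) / h + beta r q * u x) := by
  have hφ := (continuous_obstacle r q)
  have hge := le_of_ae_le hφ.continuousOn hu hadm.2.2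
  set F : ℝ → ℝ := fun x => (u x - w x) / h + beta r q * u x with hF
  have hFc : ContinuousOn F (Icc (-1) 1) :=
    ((hu.sub hw).div_const h).add (hu.const_mul (beta r q))
  have hb : ∀ e, e = -1 ∨ e = 1 → u e = obstacle r q e := fun e he =>
    sub_eq_zero.1 (hadm.2.1.eq_zero (hu.sub hφ.continuousOn) he)
  -- the continuous extension of `u` to the line
  set uE : ℝ → ℝ := IccExtend (by norm_num : (-1 : ℝ) ≤ 1) ((Icc (-1) 1).domRestrict u) with huE
  have huEc : Continuous uE := hu.domRestrict.Icc_extend'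
  have huEeq : ∀ x ∈ Icc (-1 : ℝ) 1, uE x = u x := fun x hx => by
    rw [huE, IccExtend_of_mem _ _ hx]; rfl
  have hint : ∀ ψ : TestFunction Ω ℝ ⊤,
      ∫ x, uE x * deriv (deriv ψ) x = ∫ x, u x * deriv (deriv ψ) x := by
    intro ψ
    congr 1; funext x
    by_cases hx : x ∈ Ioo (-1 : ℝ) 1
    · rw [huEeq x (Ioo_subset_Icc_self hx)]
    · have : deriv (deriv ψ) x = 0 := test_eq_zero (testDeriv (testDeriv ψ)) hx
      rw [this, mul_zero, mul_zero]
  have hFψ : ∀ ψ : TestFunction Ω ℝ ⊤, Integrable (fun x => F x * ψ x) := fun ψ =>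
    integrable_mul_test ψ (locallyIntegrableOn_of_continuousOn hFc)
  have hnhds : ∀ z ∈ Ioo (-1 : ℝ) 1, ∀ p : ℝ → Prop, (∀ᶠ x in 𝓝[Icc (-1) 1] z, p x) →
      ∃ R > 0, Metric.closedBall z R ⊆ Ioo (-1) 1 ∧ ∀ x ∈ Metric.closedBall z R, p x := by
    intro z hz p hp
    rw [nhdsWithin_eq_nhds.2 (Icc_mem_nhds hz.1 hz.2)] at hp
    obtain ⟨R, hR, hsub⟩ := Metric.nhds_basis_closedBall.mem_iff.1
      (inter_mem (Ioo_mem_nhds hz.1 hz.2) hp)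
    exact ⟨R, hR, fun x hx => (hsub hx).1, fun x hx => (hsub hx).2⟩
  have hsd : ∀ z ∈ Ioo (-1 : ℝ) 1, ∀ᶠ t in 𝓝[>] (0 : ℝ), secondDiff uE z t = secondDiff u z t := by
    intro z hz
    filter_upwards [eventually_mem_Icc_of_mem_Ioo hz] with t ht
    simp only [secondDiff]
    rw [huEeq _ ht.2.1, huEeq _ ht.2.2, huEeq _ (Ioo_subset_Icc_self hz)]
  refine ⟨hu, hge, hb _ (Or.inl rfl), hb _ (Or.inr rfl), ?_, ?_⟩
  · intro z hz c hc
    obtain ⟨R, hR, hRΩ, hRF⟩ := hnhds z hz (fun x => F x < c)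
      ((hFc z (Ioo_subset_Icc_self hz)).eventually_lt_const hc)
    filter_upwards [Ioo_mem_nhdsGT hR, hsd z hz] with t ht htu
    rw [← htu]
    refine secondDiff_le_of_integral huEc ht.1.le ht.2 fun ψ hψ hψ0 hψs => ?_
    have hψc : HasCompactSupport ψ :=
      (isCompact_closedBall z R).of_isClosed_subset (isClosed_tsupport ψ) hψs
    let Ψ : TestFunction Ω ℝ ⊤ := ⟨ψ, hψ, hψc, hψs.trans hRΩ⟩
    have hv := first_variation_nonneg hu hw hadm hmin Ψ (by
      filter_upwards [self_mem_nhdsWithin] with ε hε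
      have hε' : 0 < ε := hε
      refine ae_μΩ fun x hx => ?_
      have h1 := hge x (Ioo_subset_Icc_self hx)
      have h2 : 0 ≤ ε * Ψ x := mul_nonneg hε'.le (hψ0 x)
      linarith)
    rw [← hint Ψ] at hv
    refine hv.trans ?_
    rw [← integral_const_mul]
    refine integral_mono (hFψ Ψ) ((hψ.continuous.integrable_of_hasCompactSupport hψc).const_mul c)
      fun x => ?_
    by_cases hx : x ∈ tsupport ψ
    · exact mul_le_mul_of_nonneg_right (hRF x (hψs hx)).le (hψ0 x)
    · have : ψ x = 0 := image_eq_zero_of_notMem_tsupport hx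
      change F x * ψ x ≤ c * ψ x
      rw [this, mul_zero, mul_zero]
  · intro z hz hzφ c hc
    set δ := (u z - obstacle r q z) / 2 with hδ
    have hδ0 : 0 < δ := by rw [hδ]; linarith
    have hev : ∀ᶠ x in 𝓝[Icc (-1) 1] z, c < F x ∧ δ < u x - obstacle r q x := by
      have hz' := Ioo_subset_Icc_self hz
      refine ((hFc z hz').eventually_const_lt hc).and
        (((hu.sub hφ.continuousOn) z hz').eventually_const_lt ?_)
      change δ < u z - obstacle r q z
      rw [hδ]; linarith
    obtain ⟨R, hR, hRΩ, hRF⟩ := hnhds z hz _ hev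
    filter_upwards [Ioo_mem_nhdsGT hR, hsd z hz] with t ht htu
    rw [← htu]
    have key : secondDiff (fun x => -uE x) z t ≤ -c * t ^ 2 := by
      refine secondDiff_le_of_integral huEc.neg ht.1.le ht.2 fun ψ hψ hψ0 hψs => ?_
      have hψc : HasCompactSupport ψ :=
        (isCompact_closedBall z R).of_isClosed_subset (isClosed_tsupport ψ) hψs
      let Ψ : TestFunction Ω ℝ ⊤ := ⟨ψ, hψ, hψc, hψs.trans hRΩ⟩
      obtain ⟨K, hK⟩ := hψ.continuous.bounded_above_of_compact_support hψc
      have hK0 : 0 ≤ K := (norm_nonneg _).trans (hK 0)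
      have hv := first_variation_nonneg hu hw hadm hmin (-Ψ) (by
        filter_upwards [Ioo_mem_nhdsGT (show 0 < δ / (K + 1) by positivity)] with ε hε
        refine ae_μΩ fun x hx => ?_
        change obstacle r q x ≤ u x + ε * (-ψ x)
        by_cases hxs : x ∈ tsupport ψ
        · have h1 := (hRF x (hψs hxs)).2
          have h2 : ε * ψ x ≤ δ := by
            have h3 : ψ x ≤ K + 1 := ((le_abs_self _).trans (hK x)).trans (by linarith)
            calc ε * ψ x ≤ δ / (K + 1) * (K + 1) :=
                  mul_le_mul hε.2.le h3 (hψ0 x) (by positivity)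
              _ = δ := by field_simp
          linarith
        · rw [image_eq_zero_of_notMem_tsupport hxs]
          linarith [hge x (Ioo_subset_Icc_self hx)])
      have e1 : ∀ x, deriv (deriv (-Ψ : TestFunction Ω ℝ ⊤)) x = -deriv (deriv ψ) x := by
        intro x
        have : deriv ((-Ψ : TestFunction Ω ℝ ⊤) : ℝ → ℝ) = fun x => -deriv ψ x := by
          funext y; exact deriv.fun_neg
        rw [this]; exact deriv.fun_neg
      rw [← hint (-Ψ)] at hv
      simp only [e1] at hv
      calc ∫ x, -uE x * deriv (deriv ψ) x = ∫ x, uE x * -deriv (deriv ψ) x := by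
            congr 1; funext x; ring
        _ ≤ ∫ x, F x * (-Ψ : TestFunction Ω ℝ ⊤) x := hv
        _ ≤ ∫ x, -c * ψ x := by
            refine integral_mono (hFψ (-Ψ))
              ((hψ.continuous.integrable_of_hasCompactSupport hψc).const_mul (-c)) fun x => ?_
            change F x * (-ψ x) ≤ -c * ψ x
            by_cases hx : x ∈ tsupport ψ
            · have := mul_le_mul_of_nonneg_right (hRF x (hψs hx)).1.le (hψ0 x)
              linarith
            · rw [image_eq_zero_of_notMem_tsupport hx]; simp
        _ = -c * ∫ x, ψ x := integral_const_mul _ _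
    rw [secondDiff_neg] at key
    linarith

/-! ### Iterated resolvent kernels -/

/-- The `(n + 1)`-st convolution power of the Green function `exp (-|y|) / 2` of `1 - d²/dy²` on
the line, given by its three-term recurrence. -/
noncomputable def kern : ℕ → ℝ → ℝ
  | 0, y => Real.exp (-|y|) / 2
  | 1, y => (1 + |y|) * Real.exp (-|y|) / 4
  | n + 2, y => (2 * n + 3) / (2 * n + 4) * kern (n + 1) y
      + y ^ 2 / (4 * (n + 2) * (n + 1)) * kern n y

theorem kern_nonneg (n : ℕ) (y : ℝ) : 0 ≤ kern n y := by
  induction n using Nat.twoStepInduction with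
  | zero => rw [kern]; positivity
  | one => rw [kern]; positivity
  | more n h0 h1 => rw [kern]; positivity

theorem kern_abs (n : ℕ) (y : ℝ) : kern n |y| = kern n y := by
  induction n using Nat.twoStepInduction with
  | zero => rw [kern, kern, abs_abs]
  | one => rw [kern, kern, abs_abs]
  | more n h0 h1 => rw [kern, kern, h0, h1, sq_abs]

theorem hasDerivAt_exp_neg_abs {y : ℝ} (hy : y ≠ 0) :
    HasDerivAt (fun y : ℝ => Real.exp (-|y|)) (-(SignType.sign y : ℝ) * Real.exp (-|y|)) y := by
  refine (hasDerivAt_abs hy).fun_neg.exp.congr_deriv ?_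
  ring

theorem hasDerivAt_mul_exp_neg_abs (y : ℝ) :
    HasDerivAt (fun y : ℝ => y * Real.exp (-|y|)) ((1 - |y|) * Real.exp (-|y|)) y := by
  refine hasDerivAt_of_hasDerivAt_of_ne' (x := 0) (g := fun y => (1 - |y|) * Real.exp (-|y|))
    (fun y hy => ?_) (by fun_prop) (by fun_prop) y
  refine ((hasDerivAt_id y).mul (hasDerivAt_exp_neg_abs hy)).congr_deriv ?_
  have := self_mul_sign y
  simp only [id]
  linear_combination (-Real.exp (-|y|)) * this

theorem hasDerivAt_kern_one (y : ℝ) : HasDerivAt (kern 1) (-(y / 2) * kern 0 y) y := by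
  have h1 : kern 1 = fun y => (1 + |y|) * Real.exp (-|y|) / 4 := by funext y; rw [kern]
  have h0 : kern 0 = fun y => Real.exp (-|y|) / 2 := by funext y; rw [kern]
  rw [h1, h0]
  refine hasDerivAt_of_hasDerivAt_of_ne' (x := 0)
    (g := fun y => -(y / 2) * (Real.exp (-|y|) / 2)) (fun y hy => ?_) (by fun_prop)
    (by fun_prop) y
  refine ((((hasDerivAt_abs hy).const_add 1).mul (hasDerivAt_exp_neg_abs hy)).div_const
    4).congr_deriv ?_
  have := sign_mul_abs y
  linear_combination (-Real.exp (-|y|) / 4) * this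

/-- On the Fourier side `kern (n + 1)` is `(1 + ξ²)⁻¹ ^ (n + 2)`, and this is the identity for the
`ξ`-derivative of that power. -/
theorem hasDerivAt_kern_succ (n : ℕ) (y : ℝ) :
    HasDerivAt (kern (n + 1)) (-(y / (2 * (n + 1))) * kern n y) y := by
  induction n using Nat.twoStepInduction generalizing y with
  | zero => simpa using hasDerivAt_kern_one y
  | one =>
    have e : kern 2 = fun y => 3 / 4 * kern 1 y + y ^ 2 / 8 * kern 0 y := by
      funext y; exact (kern.eq_3 y 0).trans (by push_cast; ring)
    have h0 : (fun y => y ^ 2 / 8 * kern 0 y)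
        = fun y => y / 16 * (y * Real.exp (-|y|)) := by
      funext y; simp only [kern]; ring
    have h2 : HasDerivAt (fun y => y / 16 * (y * Real.exp (-|y|))) _ y :=
      ((hasDerivAt_id y).div_const 16).mul (hasDerivAt_mul_exp_neg_abs y)
    rw [← h0] at h2
    rw [show (1 + 1 : ℕ) = 2 from rfl, e]
    refine (((hasDerivAt_kern_one y).const_mul (3 / 4)).add h2).congr_deriv ?_
    simp only [kern, id]
    push_cast
    ring
  | more n h0 h1 =>
    have e : kern (n + 2 + 1) = fun y => (2 * (n + 1 : ℕ) + 3 : ℝ) / (2 * (n + 1 : ℕ) + 4)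
        * kern (n + 2) y + y ^ 2 / (4 * ((n + 1 : ℕ) + 2) * ((n + 1 : ℕ) + 1)) * kern (n + 1) y := by
      funext y; rw [kern]
    rw [e]
    refine (((h1 y).const_mul _).add ((((hasDerivAt_id y).pow 2).div_const _).mul
      (h0 y))).congr_deriv ?_
    rw [kern]
    simp only [id, Pi.pow_apply]
    push_cast
    field_simp
    ring

/-- The equation `kern (n + 1) - kern (n + 1)'' = kern n`, with the first derivative written as in
`hasDerivAt_kern_succ`. -/
theorem hasDerivAt_deriv_kern_succ (n : ℕ) (y : ℝ) :
    HasDerivAt (fun y => -(y / (2 * (n + 1))) * kern n y) (kern (n + 1) y - kern n y) y := by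
  cases n with
  | zero =>
    have e : (fun y : ℝ => -(y / (2 * ((0 : ℕ) + 1 : ℝ))) * kern 0 y)
        = fun y => -(1 / 4) * (y * Real.exp (-|y|)) := by
      funext y; rw [kern]; push_cast; ring
    rw [e]
    refine ((hasDerivAt_mul_exp_neg_abs y).const_mul _).congr_deriv ?_
    rw [kern, kern]
    ring
  | succ n =>
    refine ((((hasDerivAt_id y).div_const _).neg).mul (hasDerivAt_kern_succ n y)).congr_deriv ?_
    rw [kern]
    simp only [id, Pi.neg_apply]
    push_cast
    field_simp
    ring

theorem continuous_kern (n : ℕ) : Continuous (kern n) := by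
  cases n with
  | zero =>
    have : kern 0 = fun y => Real.exp (-|y|) / 2 := by funext y; rw [kern]
    rw [this]; fun_prop
  | succ n => exact continuous_iff_continuousAt.2 fun y => (hasDerivAt_kern_succ n y).continuousAt

theorem antitoneOn_kern (n : ℕ) : AntitoneOn (kern n) (Ici 0) := by
  cases n with
  | zero =>
    intro x hx y hy hxy
    rw [kern, kern, abs_of_nonneg (mem_Ici.1 hx), abs_of_nonneg (mem_Ici.1 hy)]
    gcongr
  | succ n =>
    refine antitoneOn_of_deriv_nonpos (convex_Ici 0) (continuous_kern _).continuousOn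
      (fun y _ => (hasDerivAt_kern_succ n y).differentiableAt.differentiableWithinAt)
      fun y hy => ?_
    rw [(hasDerivAt_kern_succ n y).deriv]
    rw [interior_Ici] at hy
    have h0 : 0 < y := hy
    have := kern_nonneg n y
    have : 0 ≤ y / (2 * (n + 1)) * kern n y := by positivity
    linarith

theorem kern_zero_right_le (n : ℕ) : kern n 0 ≤ 1 / (2 * √(n + 1 : ℝ)) := by
  have h1 : ∀ n : ℕ, kern (n + 1) 0 = (2 * n + 1) / (2 * n + 2) * kern n 0 := by
    intro n
    cases n with
    | zero => rw [kern, kern]; norm_num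
    | succ n => rw [kern]; push_cast; ring
  -- the squares satisfy `4 (n + 1) (kern n 0) ^ 2 ≤ 1`
  have h2 : ∀ n : ℕ, 4 * (n + 1) * kern n 0 ^ 2 ≤ 1 := by
    intro n
    induction n with
    | zero => rw [kern]; norm_num
    | succ n ih =>
      refine le_trans ?_ ih
      rw [h1, mul_pow, div_pow]
      push_cast
      have : (4 * (n + 1 + 1) * ((2 * n + 1) ^ 2 / (2 * n + 2) ^ 2) : ℝ) ≤ 4 * (n + 1) := by
        rw [← mul_div_assoc, div_le_iff₀ (by positivity)]
        nlinarith [(Nat.cast_nonneg n : (0 : ℝ) ≤ n)]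
      nlinarith [sq_nonneg (kern n 0)]
  rw [le_div_iff₀ (by positivity)]
  have h3 : (kern n 0 * (2 * √(n + 1 : ℝ))) ^ 2 ≤ 1 := by
    rw [mul_pow, mul_pow, Real.sq_sqrt (by positivity)]
    linarith [h2 n]
  exact (abs_le_one_iff_mul_self_le_one.2 (by rw [← sq]; exact h3)) |> (le_abs_self _).trans

theorem kern_le (n : ℕ) (y : ℝ) : kern n y ≤ 1 / (2 * √(n + 1 : ℝ)) := by
  rw [← kern_abs]
  exact (antitoneOn_kern n self_mem_Ici (abs_nonneg y) (abs_nonneg y)).trans (kern_zero_right_le n)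

/-- The mass of `kern n` on `[0, y]`, for `y ≥ 0`. -/
noncomputable def kernMass : ℕ → ℝ → ℝ
  | 0, y => (1 - Real.exp (-y)) / 2
  | n + 1, y => kernMass n y + -(y / (2 * (n + 1))) * kern n y

theorem continuous_kernMass (n : ℕ) : Continuous (kernMass n) := by
  induction n with
  | zero =>
    have : kernMass 0 = fun y => (1 - Real.exp (-y)) / 2 := by funext y; rw [kernMass]
    rw [this]; fun_prop
  | succ n ih =>
    have : kernMass (n + 1) = fun y => kernMass n y + -(y / (2 * (n + 1))) * kern n y := by
      funext y; rw [kernMass]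
    have := continuous_kern n
    simp_all only
    fun_prop

theorem hasDerivAt_kernMass (n : ℕ) {y : ℝ} (hy : 0 < y) :
    HasDerivAt (kernMass n) (kern n y) y := by
  induction n with
  | zero =>
    have : kernMass 0 = fun y => (1 - Real.exp (-y)) / 2 := by funext y; rw [kernMass]
    rw [this, kern, abs_of_pos hy]
    refine (((hasDerivAt_neg y).exp.const_sub 1).div_const 2).congr_deriv ?_
    ring
  | succ n ih =>
    have : kernMass (n + 1) = fun y => kernMass n y + -(y / (2 * (n + 1))) * kern n y := by
      funext y; rw [kernMass]
    rw [this]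
    exact (ih.add (hasDerivAt_deriv_kern_succ n y)).congr_deriv (by ring)

theorem kernMass_zero_right (n : ℕ) : kernMass n 0 = 0 := by
  induction n with
  | zero => rw [kernMass]; simp
  | succ n ih => rw [kernMass, ih]; simp

theorem kernMass_le (n : ℕ) {y : ℝ} (hy : 0 ≤ y) : kernMass n y ≤ 1 / 2 := by
  induction n with
  | zero => rw [kernMass]; linarith [Real.exp_pos (-y)]
  | succ n ih =>
    rw [kernMass]
    have := kern_nonneg n y
    have : 0 ≤ y / (2 * (n + 1)) * kern n y := by positivity
    linarith

/-- Since `kern n` is unimodal and has mass `1 / 2` on the half line, it decays like `1 / |y|`,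
uniformly in `n`. -/
theorem abs_mul_kern_le (n : ℕ) (y : ℝ) : |y| * kern n y ≤ 1 / 2 := by
  rcases eq_or_ne y 0 with rfl | hne
  · simp
  have hy : 0 < |y| := abs_pos.2 hne
  rw [← kern_abs]
  generalize |y| = s at hy
  obtain ⟨c, hc, hcs⟩ := exists_hasDerivAt_eq_slope (kernMass n) (kern n) hy
    (continuous_kernMass n).continuousOn fun x hx => hasDerivAt_kernMass n hx.1
  rw [kernMass_zero_right, sub_zero, sub_zero, eq_div_iff hy.ne'] at hcs
  have h1 : kern n s ≤ kern n c := antitoneOn_kern n hc.1.le hy.le hc.2.le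
  have h2 := kernMass_le n hy.le
  nlinarith

/-- The kernel of the `(n + 1)`-st power of the resolvent `(1 - h d²/dx²)⁻¹` on the line. -/
noncomputable def heatKern (h : ℝ) (n : ℕ) (x : ℝ) : ℝ := kern n (x / √h) / √h


theorem heatKern_nonneg {h : ℝ} (n : ℕ) (x : ℝ) : 0 ≤ heatKern h n x :=
  div_nonneg (kern_nonneg _ _) (Real.sqrt_nonneg _)

theorem continuous_heatKern (h : ℝ) (n : ℕ) : Continuous (heatKern h n) :=
  ((continuous_kern n).comp (continuous_id.div_const _)).div_const _

theorem heatKern_le {h : ℝ} (hh : 0 < h) (n : ℕ) (x : ℝ) :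
    heatKern h n x ≤ 1 / (2 * √((n + 1 : ℕ) * h)) := by
  have hs := Real.sqrt_pos.2 hh
  unfold heatKern
  rw [div_le_iff₀ hs, Real.sqrt_mul (by positivity)]
  refine (kern_le n _).trans (le_of_eq ?_)
  push_cast
  field_simp

theorem abs_mul_heatKern_le {h : ℝ} (hh : 0 < h) (n : ℕ) (x : ℝ) :
    |x| * heatKern h n x ≤ 1 / 2 := by
  have hs := Real.sqrt_pos.2 hh
  have := abs_mul_kern_le n (x / √h)
  rw [abs_div, abs_of_pos hs] at this
  unfold heatKern
  calc |x| * (kern n (x / √h) / √h) = |x| / √h * kern n (x / √h) := by ring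
    _ ≤ _ := this

/-- The backward Euler equation `heatKern (n + 1) - h * heatKern (n + 1)'' = heatKern n`. -/
theorem eventually_secondDiff_heatKern_le {h : ℝ} (hh : 0 < h) (n : ℕ) (z c : ℝ)
    (hc : (heatKern h (n + 1) z - heatKern h n z) / h < c) :
    ∀ᶠ t in 𝓝[>] (0 : ℝ), secondDiff (heatKern h (n + 1)) z t ≤ c * t ^ 2 := by
  have hs := Real.sqrt_pos.2 hh
  have hd : ∀ x, HasDerivAt (fun x => x / √h) (1 / √h) x := fun x => (hasDerivAt_id x).div_const _
  refine eventually_secondDiff_le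
    (w' := fun x => -(x / √h / (2 * (n + 1))) * kern n (x / √h) * (1 / √h) / √h)
    (Eventually.of_forall fun x => ?_) ?_ hc
  · exact ((hasDerivAt_kern_succ n (x / √h)).comp x (hd x)).div_const _
  · have := ((((hasDerivAt_deriv_kern_succ n (z / √h)).comp z (hd z)).mul_const
      (1 / √h)).div_const √h)
    refine this.congr_deriv ?_
    unfold heatKern
    rw [show ∀ X : ℝ, X / h = X / (√h * √h) from fun X => by rw [Real.mul_self_sqrt hh.le]]
    field_simp

/-! ### The obstacle -/

/-- The part of the obstacle to the right of `0`, extended smoothly to the line. -/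
noncomputable def obstacleRight (a x : ℝ) : ℝ := Real.exp (a * x) * (Real.exp x - 1)

/-- The derivative of `obstacleRight`. -/
noncomputable def obstacleRightDeriv (a x : ℝ) : ℝ :=
  Real.exp (a * x) * (a * (Real.exp x - 1) + Real.exp x)

theorem hasDerivAt_obstacleRight (a x : ℝ) :
    HasDerivAt (obstacleRight a) (obstacleRightDeriv a x) x := by
  have h1 : HasDerivAt (fun x => Real.exp (a * x)) (Real.exp (a * x) * (a * 1)) x :=
    ((hasDerivAt_id x).const_mul a).exp
  refine (h1.mul ((Real.hasDerivAt_exp x).sub_const 1)).congr_deriv ?_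
  unfold obstacleRightDeriv
  ring

theorem exists_lipschitz_obstacleRightDeriv (a : ℝ) : ∃ C, 0 ≤ C ∧
    ∀ x ∈ Icc (0 : ℝ) 1, ∀ y ∈ Icc (0 : ℝ) 1,
      |obstacleRightDeriv a x - obstacleRightDeriv a y| ≤ C * |x - y| := by
  have hc : ContDiff ℝ 1 (obstacleRightDeriv a) := by
    unfold obstacleRightDeriv
    fun_prop
  obtain ⟨K, hK⟩ := hc.contDiffOn.exists_lipschitzOnWith (s := Icc (0 : ℝ) 1) (by decide)
    (convex_Icc 0 1) isCompact_Icc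
  refine ⟨K, K.2, fun x hx y hy => ?_⟩
  have := hK.dist_le_mul x hx y hy
  rwa [Real.dist_eq, Real.dist_eq] at this

theorem obstacle_eq (r q x : ℝ) : obstacle r q x = obstacleRight (alpha r q) (max x 0) := by
  unfold obstacle obstacleRight
  rcases le_total x 0 with hx | hx
  · rw [max_eq_right hx, max_eq_right (by linarith [Real.exp_le_one_iff.2 hx])]
    simp
  · rw [max_eq_left hx, max_eq_left (by linarith [Real.one_le_exp hx])]

theorem obstacle_nonneg (r q x : ℝ) : 0 ≤ obstacle r q x := by
  unfold obstacle; positivity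

theorem hasDerivAt_obstacle_sub_max (r q x : ℝ) :
    HasDerivAt (fun x => obstacle r q x - max x 0)
      (obstacleRightDeriv (alpha r q) (max x 0) - 1) x := by
  have hc : Continuous (obstacleRightDeriv (alpha r q)) := by
    unfold obstacleRightDeriv
    fun_prop
  refine hasDerivAt_of_hasDerivAt_of_ne' (x := 0)
    (g := fun x => obstacleRightDeriv (alpha r q) (max x 0) - 1) (fun y hy => ?_) ?_ ?_ x
  · rcases lt_or_gt_of_ne hy with hy | hy
    · have h1 : obstacleRightDeriv (alpha r q) (max y 0) - 1 = 0 := by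
        rw [max_eq_right hy.le]; simp [obstacleRightDeriv]
      rw [h1]
      refine (hasDerivAt_const y (0 : ℝ)).congr_of_eventuallyEq ?_
      filter_upwards [Iio_mem_nhds hy] with s hs
      rw [obstacle_eq, max_eq_right (le_of_lt hs)]
      simp [obstacleRight]
    · rw [max_eq_left hy.le]
      refine ((hasDerivAt_obstacleRight (alpha r q) y).sub
        (hasDerivAt_id y)).congr_of_eventuallyEq ?_
      filter_upwards [Ioi_mem_nhds hy] with s hs
      rw [obstacle_eq, max_eq_left (le_of_lt hs)]
      rfl
  · exact ((continuous_obstacle r q).sub (by fun_prop)).continuousAt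
  · exact ((hc.comp (by fun_prop : Continuous fun x : ℝ => max x 0)).sub
      continuous_const).continuousAt

/-- Up to its kink at `0`, the obstacle has bounded second derivative. -/
theorem exists_secondDiff_obstacle_sub_max_le (r q : ℝ) : ∃ C, 0 ≤ C ∧ ∀ x t : ℝ, 0 ≤ t →
    x + t ∈ Icc (-1 : ℝ) 1 → x - t ∈ Icc (-1 : ℝ) 1 →
      |secondDiff (fun x => obstacle r q x - max x 0) x t| ≤ C * t ^ 2 := by
  obtain ⟨C, hC0, hC⟩ := exists_lipschitz_obstacleRightDeriv (alpha r q)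
  refine ⟨C, hC0, fun x t ht h1 h2 => ?_⟩
  have hlip : ∀ s, 0 ≤ s → s ≤ t →
      |(obstacleRightDeriv (alpha r q) (max (x + s) 0) - 1)
        - (obstacleRightDeriv (alpha r q) (max (x - s) 0) - 1)| ≤ 2 * C * s := by
    intro s hs0 hst
    have e1 := hC (max (x + s) 0) ⟨le_max_right _ _, max_le (by linarith [h1.2]) zero_le_one⟩
      (max (x - s) 0) ⟨le_max_right _ _, max_le (by linarith [h1.2]) zero_le_one⟩
    have e2 : |max (x + s) 0 - max (x - s) 0| ≤ 2 * s := by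
      refine (abs_max_sub_max_le_abs _ _ _).trans (le_of_eq ?_)
      rw [show x + s - (x - s) = 2 * s by ring, abs_of_nonneg (by linarith)]
    rw [sub_sub_sub_cancel_right]
    nlinarith
  refine abs_le.2 ⟨?_, ?_⟩
  · rw [← neg_mul]
    exact le_secondDiff_of_deriv ht (fun y _ => hasDerivAt_obstacle_sub_max r q y)
      fun s h0 hs => by linarith [(abs_le.1 (hlip s h0 hs)).1]
  · exact secondDiff_le_of_deriv ht (fun y _ => hasDerivAt_obstacle_sub_max r q y)
      fun s h0 hs => by linarith [(abs_le.1 (hlip s h0 hs)).2]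

theorem hasDerivAt_abs_add_exp_neg_abs (y : ℝ) :
    HasDerivAt (fun y : ℝ => |y| + Real.exp (-|y|))
      (Real.exp (min y 0) - Real.exp (-max y 0)) y := by
  refine hasDerivAt_of_hasDerivAt_of_ne' (x := 0)
    (g := fun y => Real.exp (min y 0) - Real.exp (-max y 0)) (fun y hy => ?_) (by fun_prop)
    (by fun_prop) y
  refine ((hasDerivAt_abs hy).add (hasDerivAt_exp_neg_abs hy)).congr_deriv ?_
  rcases lt_or_gt_of_ne hy with hy | hy
  · rw [min_eq_left hy.le, max_eq_right hy.le, sign_neg hy, abs_of_neg hy]; simp; ring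
  · rw [min_eq_right hy.le, max_eq_left hy.le, sign_pos hy, abs_of_pos hy]; simp; ring

theorem hasDerivAt_exp_min_sub_exp_neg_max (y : ℝ) :
    HasDerivAt (fun y : ℝ => Real.exp (min y 0) - Real.exp (-max y 0)) (Real.exp (-|y|)) y := by
  refine hasDerivAt_of_hasDerivAt_of_ne' (x := 0)
    (g := fun y => Real.exp (-|y|)) (fun y hy => ?_) (by fun_prop) (by fun_prop) y
  rcases lt_or_gt_of_ne hy with hy | hy
  · rw [abs_of_neg hy, neg_neg]
    refine ((Real.hasDerivAt_exp y).sub_const 1).congr_of_eventuallyEq ?_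
    filter_upwards [Iio_mem_nhds hy] with s hs
    rw [min_eq_left (le_of_lt hs), max_eq_right (le_of_lt hs)]; simp
  · rw [abs_of_pos hy]
    refine (((hasDerivAt_neg y).exp.const_sub 1).congr_deriv (by ring)).congr_of_eventuallyEq ?_
    filter_upwards [Ioi_mem_nhds hy] with s hs
    rw [min_eq_right (le_of_lt hs), max_eq_left (le_of_lt hs)]; simp

/-- The convex kink of `max x 0` at `0` is cancelled by the concave kink of the resolvent kernel
`h * heatKern h 0`. -/
theorem eventually_secondDiff_max_add_heatKern_le {h : ℝ} (hh : 0 < h) (z c : ℝ)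
    (hc : heatKern h 0 z < c) :
    ∀ᶠ t in 𝓝[>] (0 : ℝ),
      secondDiff (fun x => max x 0 + h * heatKern h 0 x) z t ≤ c * t ^ 2 := by
  have hs := Real.sqrt_pos.2 hh
  have e : (fun x => max x 0 + h * heatKern h 0 x)
      = fun x => x / 2 + √h / 2 * (|x / √h| + Real.exp (-|x / √h|)) := by
    funext x
    have h1 : max x 0 = x / 2 + |x| / 2 := by
      rcases le_total x 0 with hx | hx
      · rw [max_eq_right hx, abs_of_nonpos hx]; ring
      · rw [max_eq_left hx, abs_of_nonneg hx]; ring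
    have h2 : |x / √h| = |x| / √h := by rw [abs_div, abs_of_pos hs]
    unfold heatKern
    rw [kern, h1, h2]
    nth_rewrite 1 [← Real.sq_sqrt hh.le]
    field_simp
    ring
  rw [e]
  have hd : ∀ x, HasDerivAt (fun x => x / √h) (1 / √h) x := fun x => (hasDerivAt_id x).div_const _
  refine eventually_secondDiff_le (w' := fun x => 1 / 2 + √h / 2 *
    ((Real.exp (min (x / √h) 0) - Real.exp (-max (x / √h) 0)) * (1 / √h)))
    (Eventually.of_forall fun x => ?_) ?_ hc
  · exact ((hasDerivAt_id x).div_const 2).add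
      (((hasDerivAt_abs_add_exp_neg_abs (x / √h)).comp x (hd x)).const_mul _)
  · refine (((((hasDerivAt_exp_min_sub_exp_neg_max (z / √h)).comp z (hd z)).mul_const
      (1 / √h)).const_mul (√h / 2)).const_add (1 / 2)).congr_deriv ?_
    unfold heatKern
    rw [kern]
    field_simp

/-! ### Comparison principles for the discrete flow -/

/-- The implicit Euler scheme for the parabolic obstacle problem `u_t = u_xx - β u`, `u ≥ φ`,
started at the obstacle, with `N` steps of size `h`. -/
structure IsDiscreteFlow (φ : ℝ → ℝ) (β h : ℝ) (N : ℕ) (u : ℕ → ℝ → ℝ) : Prop where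
  init : EqOn (u 0) φ (Icc (-1) 1)
  step : ∀ m < N, SolvesObstacle φ (u (m + 1))
    (fun x => (u (m + 1) x - u m x) / h + β * u (m + 1) x)

namespace IsDiscreteFlow

variable {φ : ℝ → ℝ} {β h : ℝ} {N : ℕ} {u : ℕ → ℝ → ℝ}

theorem ge (H : IsDiscreteFlow φ β h N u) {m : ℕ} (hm : m ≤ N) {x : ℝ}
    (hx : x ∈ Icc (-1 : ℝ) 1) : φ x ≤ u m x := by
  cases m with
  | zero => exact (H.init hx).ge
  | succ m => exact (H.step m hm).ge x hx

theorem left (H : IsDiscreteFlow φ β h N u) {m : ℕ} (hm : m ≤ N) : u m (-1) = φ (-1) := by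
  cases m with
  | zero => exact H.init (by simp)
  | succ m => exact (H.step m hm).left

theorem right (H : IsDiscreteFlow φ β h N u) {m : ℕ} (hm : m ≤ N) : u m 1 = φ 1 := by
  cases m with
  | zero => exact H.init (by simp)
  | succ m => exact (H.step m hm).right

theorem cont (H : IsDiscreteFlow φ β h N u) (hφ : Continuous φ) {m : ℕ} (hm : m ≤ N) :
    ContinuousOn (u m) (Icc (-1) 1) := by
  cases m with
  | zero => exact hφ.continuousOn.congr H.init
  | succ m => exact (H.step m hm).cont

/-- The iterates increase with `m`: at a positive maximum of `u m - u (m + 1)` the function `u m` is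
off its contact set, so that the two equations can be compared there. -/
theorem mono (H : IsDiscreteFlow φ β h N u) (hφ : Continuous φ) (hh : 0 < h) (hβ : 0 ≤ β) {m : ℕ}
    (hm : m < N) : ∀ x ∈ Icc (-1 : ℝ) 1, u m x ≤ u (m + 1) x := by
  induction m with
  | zero =>
    intro x hx
    rw [H.init hx]
    exact H.ge hm hx
  | succ m ih =>
    have hm' : m < N := by omega
    have key := nonpos_of_secondDiff_pos (g := fun x => u (m + 1) x - u (m + 2) x)
      (by norm_num : (-1 : ℝ) ≤ 1) ((H.cont hφ hm').sub (H.cont hφ hm))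
      (by rw [H.left hm', H.left hm, sub_self])
      (by rw [H.right hm', H.right hm, sub_self]) fun z hz hpos _ => by
        have hz' := Ioo_subset_Icc_self hz
        have h1 := ih hm' z hz'
        have hlt : (u (m + 2) z - u (m + 1) z) / h + β * u (m + 2) z
            < (u (m + 1) z - u m z) / h + β * u (m + 1) z := by
          have e1 : (u (m + 2) z - u (m + 1) z) / h < 0 :=
            div_neg_of_neg_of_pos (by linarith) hh
          have e2 : 0 ≤ (u (m + 1) z - u m z) / h := div_nonneg (by linarith) hh.le
          have e3 : β * u (m + 2) z ≤ β * u (m + 1) z :=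
            mul_le_mul_of_nonneg_left (by linarith) hβ
          linarith
        obtain ⟨b, hb1, hb2⟩ := exists_between hlt
        obtain ⟨a, ha1, ha2⟩ := exists_between hb2
        refine Eventually.frequently ?_
        filter_upwards [(H.step (m + 1) hm).super z hz b hb1,
          (H.step m hm').sub z hz (by linarith [H.ge hm hz']) a ha2,
          self_mem_nhdsWithin] with t ht1 ht2 ht0
        have ht0' : 0 < t := ht0
        have e1 : secondDiff (fun x => u (m + 1) x - u (m + 2) x) z t
            = secondDiff (u (m + 1)) z t - secondDiff (u (m + 2)) z t := by
          simp only [secondDiff]; ring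
        rw [e1]
        have : b * t ^ 2 < a * t ^ 2 := by gcongr
        linarith
    intro x hx
    linarith [key x hx]

theorem le_of_le (H : IsDiscreteFlow φ β h N u) (hφ : Continuous φ) (hh : 0 < h) (hβ : 0 < β)
    {M : ℝ} (hM0 : 0 ≤ M) (hM : ∀ x ∈ Icc (-1 : ℝ) 1, φ x ≤ M) {m : ℕ} (hm : m ≤ N) :
    ∀ x ∈ Icc (-1 : ℝ) 1, u m x ≤ M := by
  cases m with
  | zero =>
    intro x hx
    rw [H.init hx]
    exact hM x hx
  | succ m =>
    have key := nonpos_of_secondDiff_pos (g := fun x => u (m + 1) x - M)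
      (by norm_num : (-1 : ℝ) ≤ 1) ((H.cont hφ hm).sub continuousOn_const)
      (by rw [H.left hm]; linarith [hM (-1) (by simp)])
      (by rw [H.right hm]; linarith [hM 1 (by simp)]) fun z hz hpos _ => by
        have hz' := Ioo_subset_Icc_self hz
        have h1 := H.mono hφ hh hβ.le hm z hz'
        have hF : 0 < (u (m + 1) z - u m z) / h + β * u (m + 1) z := by
          have e2 : 0 ≤ (u (m + 1) z - u m z) / h := div_nonneg (by linarith) hh.le
          have e3 : 0 < β * u (m + 1) z := mul_pos hβ (by linarith)
          linarith
        obtain ⟨a, ha1, ha2⟩ := exists_between hF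
        refine Eventually.frequently ?_
        filter_upwards [(H.step m hm).sub z hz (by linarith [hM z hz']) a ha2,
          self_mem_nhdsWithin] with t ht2 ht0
        have ht0' : 0 < t := ht0
        have e1 : secondDiff (fun x => u (m + 1) x - M) z t = secondDiff (u (m + 1)) z t := by
          simp only [secondDiff]; ring
        rw [e1]
        have : 0 < a * t ^ 2 := by positivity
        linarith
    intro x hx
    linarith [key x hx]

end IsDiscreteFlow

section Obstacle

variable {r q β h C : ℝ} {N : ℕ} {u : ℕ → ℝ → ℝ}

/-- The difference quotient in time is dominated by the backward Euler solution with initial datum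
`δ₀ + C`: off the contact set the difference quotient is a subsolution, and on the contact set it
vanishes. -/
theorem IsDiscreteFlow.diff_le (H : IsDiscreteFlow (obstacle r q) β h N u) (hh : 0 < h)
    (hβ : 0 ≤ β) (hC0 : 0 ≤ C)
    (hC : ∀ x t : ℝ, 0 ≤ t → x + t ∈ Icc (-1 : ℝ) 1 → x - t ∈ Icc (-1 : ℝ) 1 →
      |secondDiff (fun x => obstacle r q x - max x 0) x t| ≤ C * t ^ 2)
    {m : ℕ} (hm : m < N) :
    ∀ x ∈ Icc (-1 : ℝ) 1, (u (m + 1) x - u m x) / h ≤ heatKern h m x + C := by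
  have hφ := continuous_obstacle r q
  suffices hs : ∀ x ∈ Icc (-1 : ℝ) 1,
      u (m + 1) x - u m x - h * heatKern h m x - h * C ≤ 0 by
    intro x hx
    rw [div_le_iff₀ hh]
    linarith [hs x hx]
  have hbd : ∀ (m : ℕ) (y : ℝ), 0 ≤ h * heatKern h m y + h * C := fun m y => by
    have := heatKern_nonneg (h := h) m y
    positivity
  have hcont : ∀ m < N,
      ContinuousOn (fun x => u (m + 1) x - u m x - h * heatKern h m x - h * C) (Icc (-1) 1) :=
    fun m hm => (((H.cont hφ hm).sub (H.cont hφ hm.le)).sub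
      ((continuous_heatKern h m).const_mul h).continuousOn).sub continuousOn_const
  induction m with
  | zero =>
    -- the obstacle is split into its kink `max x 0`, handled together with the kernel, and the rest
    refine nonpos_of_secondDiff_pos (by norm_num : (-1 : ℝ) ≤ 1) (hcont 0 hm)
      (by rw [H.left hm, H.left hm.le]; linarith [hbd 0 (-1)])
      (by rw [H.right hm, H.right hm.le]; linarith [hbd 0 1]) fun z hz hpos _ => ?_
    have hz' := Ioo_subset_Icc_self hz
    rw [zero_add] at hpos
    have h0 : 0 ≤ u 1 z := (obstacle_nonneg r q z).trans (H.ge hm hz')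
    have hcontact : obstacle r q z < u 1 z := by
      rw [← H.init hz']; linarith [hbd 0 z]
    have hF : heatKern h 0 z < (u 1 z - u 0 z) / h + β * u 1 z - C := by
      have e1 : heatKern h 0 z + C < (u 1 z - u 0 z) / h := by
        rw [lt_div_iff₀ hh]; linarith
      have e2 : 0 ≤ β * u 1 z := mul_nonneg hβ h0
      linarith
    obtain ⟨b, hb1, hb2⟩ := exists_between hF
    obtain ⟨a, ha1, ha2⟩ := exists_between hb2
    refine Eventually.frequently ?_
    filter_upwards [(H.step 0 hm).sub z hz hcontact (a + C) (by simp only [zero_add]; linarith),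
      eventually_secondDiff_max_add_heatKern_le hh z b hb1,
      eventually_mem_Icc_of_mem_Ioo hz] with t ht1 ht2 ht0
    have e1 : secondDiff (fun x => u (0 + 1) x - u 0 x - h * heatKern h 0 x - h * C) z t
        = secondDiff (u (0 + 1)) z t - secondDiff (fun x => max x 0 + h * heatKern h 0 x) z t
          - secondDiff (fun x => obstacle r q x - max x 0) z t := by
      simp only [secondDiff]
      rw [H.init hz', H.init ht0.2.1, H.init ht0.2.2]
      ring
    rw [e1]
    have h3 := (abs_le.1 (hC z t ht0.1.le ht0.2.1 ht0.2.2)).2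
    have ht0' := ht0.1
    have : b * t ^ 2 < a * t ^ 2 := by gcongr
    linarith
  | succ m ih =>
    have hm' : m < N := by omega
    refine nonpos_of_secondDiff_pos (by norm_num : (-1 : ℝ) ≤ 1) (hcont (m + 1) hm)
      (by rw [H.left hm, H.left hm.le]; linarith [hbd (m + 1) (-1)])
      (by rw [H.right hm, H.right hm.le]; linarith [hbd (m + 1) 1]) fun z hz hpos _ => ?_
    have hz' := Ioo_subset_Icc_self hz
    have hprev := ih hm' z hz'
    have hmono := H.mono hφ hh hβ hm z hz'
    have hcontact : obstacle r q z < u (m + 1 + 1) z := by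
      linarith [hbd (m + 1) z, H.ge hm' hz']
    set A := (u (m + 1 + 1) z - u (m + 1) z) / h + β * u (m + 1 + 1) z with hA
    set B := (u (m + 1) z - u m z) / h + β * u (m + 1) z with hB
    have hF : (heatKern h (m + 1) z - heatKern h m z) / h < (A - B) / h := by
      rw [div_lt_div_iff_of_pos_right hh]
      have e1 : heatKern h (m + 1) z + C < (u (m + 1 + 1) z - u (m + 1) z) / h := by
        rw [lt_div_iff₀ hh]; linarith
      have e2 : (u (m + 1) z - u m z) / h ≤ heatKern h m z + C := by
        rw [div_le_iff₀ hh]; linarith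
      have e3 : β * u (m + 1) z ≤ β * u (m + 1 + 1) z := mul_le_mul_of_nonneg_left hmono hβ
      linarith
    obtain ⟨b, hb1, hb2⟩ := exists_between hF
    rw [lt_div_iff₀ hh] at hb2
    have hgap : 0 < (A - B - b * h) / 3 := by linarith
    set ε := (A - B - b * h) / 3 with hε
    refine Eventually.frequently ?_
    filter_upwards [(H.step (m + 1) hm).sub z hz hcontact (A - ε) (by linarith),
      (H.step m hm').super z hz (B + ε) (by linarith),
      eventually_secondDiff_heatKern_le hh m z b hb1, self_mem_nhdsWithin] with t ht1 ht2 ht3 ht0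
    have ht0' : 0 < t := ht0
    have e1 : secondDiff (fun x => u (m + 1 + 1) x - u (m + 1) x - h * heatKern h (m + 1) x
        - h * C) z t = secondDiff (u (m + 1 + 1)) z t - secondDiff (u (m + 1)) z t
          - h * secondDiff (heatKern h (m + 1)) z t := by
      simp only [secondDiff]; ring
    rw [e1]
    have h4 : h * secondDiff (heatKern h (m + 1)) z t ≤ h * (b * t ^ 2) := by gcongr
    have h5 : 0 < ε * t ^ 2 := by positivity
    have h6 : A - ε - (B + ε) - b * h = ε := by rw [hε]; ring
    have h7 : (A - ε) * t ^ 2 - (B + ε) * t ^ 2 - h * (b * t ^ 2) = ε * t ^ 2 := by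
      rw [← h6]; ring
    linarith

/-- The iterates are semiconvex: on the contact set this is inherited from the obstacle, whose
kink at `0` is convex, and off the contact set `u'' ≥ 0`. -/
theorem IsDiscreteFlow.le_secondDiff (H : IsDiscreteFlow (obstacle r q) β h N u) (hh : 0 < h)
    (hβ : 0 ≤ β) (hC0 : 0 ≤ C)
    (hC : ∀ x t : ℝ, 0 ≤ t → x + t ∈ Icc (-1 : ℝ) 1 → x - t ∈ Icc (-1 : ℝ) 1 →
      |secondDiff (fun x => obstacle r q x - max x 0) x t| ≤ C * t ^ 2)
    {m : ℕ} (hm : m ≤ N) {z : ℝ} (hz : z ∈ Ioo (-1 : ℝ) 1) :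
    ∀ᶠ t in 𝓝[>] (0 : ℝ), -(C + 1) * t ^ 2 ≤ secondDiff (u m) z t := by
  have hφ := continuous_obstacle r q
  have hz' := Ioo_subset_Icc_self hz
  rcases (H.ge hm hz').eq_or_lt with hcontact | hcontact
  · filter_upwards [eventually_mem_Icc_of_mem_Ioo hz] with t ht
    have h1 := H.ge hm ht.2.1
    have h2 := H.ge hm ht.2.2
    have h3 := (abs_le.1 (hC z t ht.1.le ht.2.1 ht.2.2)).1
    have h4 : 0 ≤ max (z + t) 0 + max (z - t) 0 - 2 * max z 0 := by
      rcases le_total z 0 with h0 | h0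
      · rw [max_eq_right h0]
        linarith [le_max_right (z + t) 0, le_max_right (z - t) 0]
      · rw [max_eq_left h0]
        linarith [le_max_left (z + t) 0, le_max_left (z - t) 0]
    simp only [secondDiff] at h3 ⊢
    nlinarith [sq_nonneg t]
  · cases m with
    | zero => exact absurd (H.init hz') hcontact.ne'
    | succ m =>
      have hF : 0 ≤ (u (m + 1) z - u m z) / h + β * u (m + 1) z :=
        add_nonneg (div_nonneg (by linarith [H.mono hφ hh hβ hm z hz']) hh.le)
          (mul_nonneg hβ ((obstacle_nonneg r q z).trans (H.ge hm hz')))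
      exact (H.step m hm).sub z hz hcontact _ (by linarith)

end Obstacle

/-! ### Lipschitz bound in space -/

/-- The constant is `K + 1` rather than `K` to make the second differences strictly positive. -/
theorem convexOn_add_sq {u : ℝ → ℝ} {K : ℝ} (hu : ContinuousOn u (Icc (-1) 1))
    (h : ∀ z ∈ Ioo (-1 : ℝ) 1, ∀ᶠ t in 𝓝[>] (0 : ℝ), -K * t ^ 2 ≤ secondDiff u z t) :
    ConvexOn ℝ (Icc (-1) 1) (fun x => u x + (K + 1) / 2 * x ^ 2) := by
  refine convexOn_of_secondDiff_pos (hu.add (by fun_prop)) fun z hz => Eventually.frequently ?_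
  filter_upwards [h z hz, self_mem_nhdsWithin] with t ht ht0
  have ht0' : 0 < t := ht0
  have e : secondDiff (fun x => u x + (K + 1) / 2 * x ^ 2) z t
      = secondDiff u z t + (K + 1) * t ^ 2 := by
    simp only [secondDiff]; ring
  rw [e]
  have : 0 < t ^ 2 := by positivity
  linarith

/-- A semiconvex function above a Lipschitz obstacle, equal to it at the end points, is Lipschitz:
its slopes are controlled by those at the end points. -/
theorem abs_sub_le_of_convexOn {φ u : ℝ → ℝ} {K L : ℝ} (hK : 0 ≤ K)
    (hu : ConvexOn ℝ (Icc (-1) 1) (fun x => u x + K / 2 * x ^ 2))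
    (hge : ∀ x ∈ Icc (-1 : ℝ) 1, φ x ≤ u x) (hleft : u (-1) = φ (-1)) (hright : u 1 = φ 1)
    (hφ : ∀ x ∈ Icc (-1 : ℝ) 1, ∀ y ∈ Icc (-1 : ℝ) 1, |φ x - φ y| ≤ L * |x - y|) :
    ∀ x ∈ Icc (-1 : ℝ) 1, ∀ y ∈ Icc (-1 : ℝ) 1, |u x - u y| ≤ (L + 2 * K) * |x - y| := by
  have main : ∀ x ∈ Icc (-1 : ℝ) 1, ∀ y ∈ Icc (-1 : ℝ) 1, x < y →
      |u x - u y| ≤ (L + 2 * K) * |x - y| := by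
    intro x hx y hy hxy
    have hl : (-1 : ℝ) ∈ Icc (-1 : ℝ) 1 := by simp
    have hr : (1 : ℝ) ∈ Icc (-1 : ℝ) 1 := by simp
    have hpos : 0 < y - x := sub_pos.2 hxy
    rw [abs_sub_comm x y, abs_of_pos hpos, abs_le]
    have hKxy : 0 ≤ K * (y - x) := by positivity
    constructor
    · rcases hy.2.eq_or_lt with hy1 | hy1
      · have h1 := hφ 1 hr x hx
        rw [abs_of_nonneg (by linarith [hx.2] : (0 : ℝ) ≤ 1 - x)] at h1
        rw [hy1, hright]
        rw [hy1] at hKxy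
        linarith [hge x hx, (abs_le.1 h1).2]
      · have h0 := hu.slope_mono_adjacent hx hr hxy hy1
        have h1 := hφ 1 hr y hy
        rw [abs_of_nonneg (by linarith : (0 : ℝ) ≤ 1 - y)] at h1
        have h2 := (abs_le.1 h1).2
        have h3 : (u 1 + K / 2 * 1 ^ 2 - (u y + K / 2 * y ^ 2)) / (1 - y) ≤ L + K := by
          rw [div_le_iff₀ (by linarith), hright]
          nlinarith [hge y hy, mul_nonneg hK (mul_nonneg (sub_nonneg.2 hy.2) (sub_nonneg.2 hy.2))]
        have h4 := h0.trans h3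
        rw [div_le_iff₀ hpos] at h4
        nlinarith [mul_nonneg hKxy (by linarith [hx.1, hy.1] : 0 ≤ x + y + 2)]
    · rcases hx.1.eq_or_lt with hx1 | hx1
      · have h1 := hφ y hy (-1) hl
        rw [abs_of_nonneg (by linarith [hy.1] : (0 : ℝ) ≤ y - -1)] at h1
        rw [← hx1, hleft]
        rw [← hx1] at hKxy
        linarith [hge y hy, (abs_le.1 h1).1]
      · have h0 := hu.slope_mono_adjacent hl hy hx1 hxy
        have h1 := hφ x hx (-1) hl
        rw [abs_of_nonneg (by linarith : (0 : ℝ) ≤ x - -1)] at h1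
        have h2 := (abs_le.1 h1).1
        have h3 : -(L + K) ≤ (u x + K / 2 * x ^ 2 - (u (-1) + K / 2 * (-1) ^ 2)) / (x - -1) := by
          rw [le_div_iff₀ (by linarith), hleft]
          nlinarith [hge x hx, mul_nonneg hK (mul_nonneg (by linarith : 0 ≤ x + 1)
            (by linarith : 0 ≤ x + 1))]
        have h4 := h3.trans h0
        rw [le_div_iff₀ hpos] at h4
        nlinarith [mul_nonneg hKxy (by linarith [hx.2, hy.2] : 0 ≤ 2 - x - y)]
  intro x hx y hy
  rcases lt_trichotomy x y with hxy | rfl | hxy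
  · exact main x hx y hy hxy
  · simp
  · rw [abs_sub_comm (u x), abs_sub_comm x]
    exact main y hy x hx hxy

theorem exists_lipschitz_obstacle (r q : ℝ) : ∃ L, 0 ≤ L ∧ ∀ x ∈ Icc (-1 : ℝ) 1,
    ∀ y ∈ Icc (-1 : ℝ) 1, |obstacle r q x - obstacle r q y| ≤ L * |x - y| := by
  have hc : ContDiff ℝ 1 (obstacleRight (alpha r q)) := by
    unfold obstacleRight
    fun_prop
  obtain ⟨K, hK⟩ := hc.contDiffOn.exists_lipschitzOnWith (s := Icc (0 : ℝ) 1) (by decide)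
    (convex_Icc 0 1) isCompact_Icc
  refine ⟨K, K.2, fun x hx y hy => ?_⟩
  have := hK.dist_le_mul (max x 0) ⟨le_max_right _ _, max_le hx.2 zero_le_one⟩
    (max y 0) ⟨le_max_right _ _, max_le hy.2 zero_le_one⟩
  rw [Real.dist_eq, Real.dist_eq] at this
  rw [obstacle_eq, obstacle_eq]
  exact this.trans (mul_le_mul_of_nonneg_left (abs_max_sub_max_le_abs x y 0) K.2)

/-! ### Second weak derivatives -/

/-- A function which is both semiconvex and semiconcave is differentiable. -/
theorem differentiableAt_of_convexOn {u : ℝ → ℝ} {K K' : ℝ}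
    (h1 : ConvexOn ℝ (Icc (-1) 1) (fun x => u x + K / 2 * x ^ 2))
    (h2 : ConvexOn ℝ (Icc (-1) 1) (fun x => -u x + K' / 2 * x ^ 2)) {x : ℝ}
    (hx : x ∈ Ioo (-1 : ℝ) 1) : DifferentiableAt ℝ u x := by
  have hxi : x ∈ interior (Icc (-1 : ℝ) 1) := by rwa [interior_Icc]
  have hsq : ∀ (c : ℝ) (s : Set ℝ), HasDerivWithinAt (fun x : ℝ => c / 2 * x ^ 2) (c * x) s x := by
    intro c s
    refine (((hasDerivAt_id x).pow 2).const_mul (c / 2)).hasDerivWithinAt.congr_deriv ?_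
    simp
    ring
  have r1 := (h1.hasDerivWithinAt_rightDeriv_of_mem_interior hxi).sub (hsq K _)
  have l1 := (h1.hasDerivWithinAt_leftDeriv_of_mem_interior hxi).sub (hsq K _)
  have r2 := (hsq K' _).sub (h2.hasDerivWithinAt_rightDeriv_of_mem_interior hxi)
  have l2 := (hsq K' _).sub (h2.hasDerivWithinAt_leftDeriv_of_mem_interior hxi)
  have i1 := h1.leftDeriv_le_rightDeriv_of_mem_interior hxi
  have i2 := h2.leftDeriv_le_rightDeriv_of_mem_interior hxi
  have e1 : (fun x => u x + K / 2 * x ^ 2) - (fun x => K / 2 * x ^ 2) = u := by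
    funext y; simp
  have e2 : (fun x => K' / 2 * x ^ 2) - (fun x => -u x + K' / 2 * x ^ 2) = u := by
    funext y; simp
  rw [e1] at r1 l1
  rw [e2] at r2 l2
  have er := (uniqueDiffWithinAt_Ioi x).eq_deriv _ r1 r2
  have el := (uniqueDiffWithinAt_Iio x).eq_deriv _ l1 l2
  have heq : derivWithin (fun x => u x + K / 2 * x ^ 2) (Iio x) x
      = derivWithin (fun x => u x + K / 2 * x ^ 2) (Ioi x) x := by linarith
  rw [heq] at l1
  have := (hasDerivWithinAt_Iio_iff_Iic.1 l1).union (hasDerivWithinAt_Ioi_iff_Ici.1 r1)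
  rw [Iic_union_Ici, hasDerivWithinAt_univ] at this
  exact this.differentiableAt

theorem hasWeakDeriv_of_hasDerivAt {u v : ℝ → ℝ} (hu : ContinuousOn u (Icc (-1) 1))
    (hv : ContinuousOn v (Icc (-1) 1)) (h : ∀ x ∈ Ioo (-1 : ℝ) 1, HasDerivAt u (v x) x) :
    HasWeakDeriv u v := by
  have hul := locallyIntegrableOn_of_continuousOn hu
  have hvl := locallyIntegrableOn_of_continuousOn hv
  refine ⟨hul, hvl, fun ψ => ?_⟩
  refine (integral_mul_test (testDeriv ψ) u).trans ?_
  rw [integral_mul_test ψ v]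
  exact integral_mul_deriv_eq_deriv_mul_of_integrable
    (fun x hx => h x (ψ.tsupport_subset hx)) (fun x _ => test_hasDerivAt ψ x)
    (integrable_mul_test (testDeriv ψ) hul) (integrable_mul_test ψ hvl)
    (integrable_mul_test ψ hul)

theorem hasWeakDeriv_of_lipschitzWith {v : ℝ → ℝ} {D : NNReal} (hv : LipschitzWith D v) :
    HasWeakDeriv v (deriv v) := by
  have hmeas : AEStronglyMeasurable (deriv v) μΩ := (measurable_deriv v).aestronglyMeasurable
  have hint : Integrable (deriv v) μΩ :=
    Integrable.of_bound hmeas D (Eventually.of_forall fun x => norm_deriv_le_of_lipschitz hv)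
  refine ⟨locallyIntegrableOn_of_continuousOn hv.continuous.continuousOn,
    IntegrableOn.locallyIntegrableOn hint, fun ψ => ?_⟩
  have h1 : AbsolutelyContinuousOnInterval v (-1) 1 :=
    (hv.lipschitzOnWith (s := uIcc (-1) 1)).absolutelyContinuousOnInterval
  have h2 : AbsolutelyContinuousOnInterval ψ (-1) 1 :=
    (((test_contDiff ψ).of_le (by exact_mod_cast le_top)).contDiffOn
      (s := uIcc (-1) 1)).absolutelyContinuousOnInterval
  have key := h1.integral_mul_deriv_eq_deriv_mul h2
  rw [test_eq_zero ψ (by simp : (1 : ℝ) ∉ Ioo (-1 : ℝ) 1),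
    test_eq_zero ψ (by simp : (-1 : ℝ) ∉ Ioo (-1 : ℝ) 1), mul_zero, mul_zero, sub_zero, zero_sub,
    intervalIntegral.integral_of_le (by norm_num), intervalIntegral.integral_of_le (by norm_num),
    integral_Ioc_eq_integral_Ioo, integral_Ioc_eq_integral_Ioo] at key
  exact key

theorem exists_lipschitzWith_deriv {u : ℝ → ℝ} {K K' : ℝ} (hK : 0 ≤ K) (hK' : 0 ≤ K')
    (h1 : ConvexOn ℝ (Icc (-1) 1) (fun x => u x + K / 2 * x ^ 2))
    (h2 : ConvexOn ℝ (Icc (-1) 1) (fun x => -u x + K' / 2 * x ^ 2)) :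
    ∃ (D : NNReal) (v : ℝ → ℝ), LipschitzWith D v ∧
      ∀ x ∈ Ioo (-1 : ℝ) 1, HasDerivAt u (v x) x := by
  have hd : ∀ x ∈ Ioo (-1 : ℝ) 1, DifferentiableAt ℝ u x := fun x hx =>
    differentiableAt_of_convexOn h1 h2 hx
  have hsq : ∀ c x : ℝ, HasDerivAt (fun x : ℝ => c / 2 * x ^ 2) (c * x) x := by
    intro c x
    refine (((hasDerivAt_id x).pow 2).const_mul (c / 2)).congr_deriv ?_
    simp
    ring
  have d1 : ∀ x ∈ Ioo (-1 : ℝ) 1,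
      HasDerivAt (fun x => u x + K / 2 * x ^ 2) (deriv u x + K * x) x := fun x hx =>
    (hd x hx).hasDerivAt.add (hsq K x)
  have d2 : ∀ x ∈ Ioo (-1 : ℝ) 1,
      HasDerivAt (fun x => -u x + K' / 2 * x ^ 2) (-deriv u x + K' * x) x := fun x hx =>
    (hd x hx).hasDerivAt.neg.add (hsq K' x)
  have m1 := (h1.subset Ioo_subset_Icc_self (convex_Ioo (-1 : ℝ) 1)).monotoneOn_deriv
    fun x hx => (d1 x hx).differentiableAt
  have m2 := (h2.subset Ioo_subset_Icc_self (convex_Ioo (-1 : ℝ) 1)).monotoneOn_deriv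
    fun x hx => (d2 x hx).differentiableAt
  have hlip : LipschitzOnWith ⟨K + K', add_nonneg hK hK'⟩ (deriv u) (Ioo (-1 : ℝ) 1) := by
    refine LipschitzOnWith.of_le_add_mul _ fun x hx y hy => ?_
    rw [Real.dist_eq]
    change deriv u x ≤ deriv u y + (K + K') * |x - y|
    rcases le_total x y with hxy | hxy
    · have := m1 hx hy hxy
      rw [(d1 x hx).deriv, (d1 y hy).deriv] at this
      rw [abs_of_nonpos (by linarith)]
      nlinarith
    · have := m2 hy hx hxy
      rw [(d2 x hx).deriv, (d2 y hy).deriv] at this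
      rw [abs_of_nonneg (by linarith)]
      nlinarith
  obtain ⟨v, hv, hvu⟩ := hlip.extend_real
  exact ⟨_, v, hv, fun x hx => hvu hx ▸ (hd x hx).hasDerivAt⟩

/-- Two-sided bounds on second differences give `W^{2,∞}` regularity and the corresponding bounds
on the second weak derivative. -/
theorem memW_two_top_of_secondDiff {u F : ℝ → ℝ} {K B : ℝ} (hK : 0 ≤ K) (hB0 : 0 ≤ B)
    (hu : ContinuousOn u (Icc (-1) 1))
    (hlow : ∀ z ∈ Ioo (-1 : ℝ) 1, ∀ᶠ t in 𝓝[>] (0 : ℝ), -K * t ^ 2 ≤ secondDiff u z t)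
    (hup : ∀ z ∈ Ioo (-1 : ℝ) 1, ∀ c, F z < c →
      ∀ᶠ t in 𝓝[>] (0 : ℝ), secondDiff u z t ≤ c * t ^ 2)
    (hB : ∀ z ∈ Ioo (-1 : ℝ) 1, F z < B) :
    MemW 2 ⊤ u ∧ ∀ᵐ x ∂μΩ, -K ≤ weakDeriv (weakDeriv u) x ∧ weakDeriv (weakDeriv u) x ≤ F x := by
  have c1 := convexOn_add_sq hu hlow
  have c2 := convexOn_add_sq (u := fun x => -u x) (K := B) hu.neg fun z hz => by
    filter_upwards [hup z hz B (hB z hz)] with t ht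
    rw [secondDiff_neg]
    linarith
  obtain ⟨D, v, hv, huv⟩ := exists_lipschitzWith_deriv (by linarith) (by linarith) c1 c2
  have w1 : HasWeakDeriv u v := hasWeakDeriv_of_hasDerivAt hu hv.continuous.continuousOn huv
  have w2 : HasWeakDeriv v (deriv v) := hasWeakDeriv_of_lipschitzWith hv
  have w3 : HasWeakDeriv (weakDeriv u) (deriv v) :=
    w2.congr_left w1.weakDeriv_ae_eq.symm w1.hasWeakDeriv_weakDeriv.2.1
  refine ⟨⟨memLp_μΩ_of_continuousOn hu, v, w1, memLp_μΩ_of_continuousOn hv.continuous.continuousOn,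
    deriv v, w2, ?_⟩, ?_⟩
  · exact MemLp.of_bound (measurable_deriv v).aestronglyMeasurable D
      (Eventually.of_forall fun x => norm_deriv_le_of_lipschitz hv)
  · have hdiff : ∀ᵐ x ∂μΩ, DifferentiableAt ℝ v x :=
      ae_restrict_of_ae hv.ae_differentiableAt_real
    have hmem : ∀ᵐ x ∂μΩ, x ∈ Ioo (-1 : ℝ) 1 := ae_μΩ fun x hx => hx
    filter_upwards [hdiff, hmem, w3.weakDeriv_ae_eq] with x hx hxm hxw
    rw [hxw]
    have hnear : ∀ᶠ y in 𝓝 x, HasDerivAt u (v y) y := by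
      filter_upwards [Ioo_mem_nhds hxm.1 hxm.2] with y hy using huv y hy
    constructor
    · by_contra! hlt
      obtain ⟨c, hc1, hc2⟩ := exists_between hlt
      obtain ⟨t, ht1, ht2, ht0⟩ := ((hlow x hxm).and
        ((eventually_secondDiff_le hnear hx.hasDerivAt hc1).and self_mem_nhdsWithin)).exists
      have ht0' : 0 < t := ht0
      have : c * t ^ 2 < -K * t ^ 2 := by gcongr
      linarith
    · by_contra! hlt
      obtain ⟨a, ha1, ha2⟩ := exists_between hlt
      obtain ⟨c, hc1, hc2⟩ := exists_between ha2
      obtain ⟨t, ht1, ht2, ht0⟩ := ((hup x hxm a ha1).and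
        ((eventually_le_secondDiff hnear hx.hasDerivAt hc2).and self_mem_nhdsWithin)).exists
      have ht0' : 0 < t := ht0
      have : a * t ^ 2 < c * t ^ 2 := by gcongr
      linarith

/-! ### Estimates for the discrete Morse semiflow -/

theorem IsDMS.isDiscreteFlow {r q T h : ℝ} {u : ℕ → ℝ → ℝ} (H : IsDMS r q T h u) :
    IsDiscreteFlow (obstacle r q) (beta r q) h ⌊T / h⌋₊ u where
  init := H.init
  step m hm := solvesObstacle_of_minimal (H.cont _ hm) (H.cont _ hm.le)
    (H.admissible _ (by omega) hm) (H.minimal _ (by omega) hm)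

theorem exists_obstacle_le (r q : ℝ) : ∃ M, 0 ≤ M ∧ ∀ x ∈ Icc (-1 : ℝ) 1, obstacle r q x ≤ M := by
  obtain ⟨M, hM⟩ := isCompact_Icc.exists_bound_of_continuousOn
    (continuous_obstacle r q).continuousOn (s := Icc (-1 : ℝ) 1)
  exact ⟨M, (norm_nonneg _).trans (hM 0 (by simp)), fun x hx => (le_abs_self _).trans (hM x hx)⟩

/-- Telescoping of one-step bounds. -/
theorem sub_le_of_step_le {a : ℕ → ℝ} {g : ℕ → ℝ} {n m : ℕ} (hnm : n ≤ m)
    (h : ∀ k, n ≤ k → k < m → a (k + 1) - a k ≤ g (k + 1) - g k) : a m - a n ≤ g m - g n := by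
  induction m, hnm using Nat.le_induction with
  | base => simp
  | succ m hnm ih =>
    linarith [h m hnm (Nat.lt_succ_self m), ih fun k h1 h2 => h k h1 (h2.trans (Nat.lt_succ_self m))]

theorem one_div_two_mul_sqrt_le {h : ℝ} (hh : 0 < h) (k : ℕ) :
    h * (1 / (2 * √((k + 1 : ℕ) * h))) ≤ √((k + 1 : ℕ) * h) - √((k : ℕ) * h) := by
  have hpos : 0 < √((k + 1 : ℕ) * h) := Real.sqrt_pos.2 (by positivity)
  have h1 : √((k + 1 : ℕ) * h) ^ 2 = (k + 1 : ℕ) * h := Real.sq_sqrt (by positivity)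
  have h2 : √((k : ℕ) * h) ^ 2 = (k : ℕ) * h := Real.sq_sqrt (by positivity)
  rw [mul_one_div, div_le_iff₀ (by positivity)]
  push_cast at h1 h2 ⊢
  nlinarith [sq_nonneg (√(((k : ℝ) + 1) * h) - √((k : ℝ) * h))]

theorem sqrt_sub_sqrt_le {a b : ℝ} (ha : 0 ≤ a) (hab : a ≤ b) : √b - √a ≤ √(b - a) := by
  rw [sub_le_iff_le_add]
  refine (Real.sqrt_le_sqrt (le_of_eq (by ring : b = (b - a) + a))).trans ?_
  rw [Real.sqrt_le_left (by positivity), add_sq, Real.sq_sqrt (sub_nonneg.2 hab), Real.sq_sqrt ha]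
  have := mul_nonneg (Real.sqrt_nonneg (b - a)) (Real.sqrt_nonneg a)
  linarith

section Estimates

variable {r q T h C : ℝ} {u : ℕ → ℝ → ℝ}

theorem beta_pos (hr : 0 < r) : 0 < beta r q := by
  unfold beta; positivity

theorem IsDMS.diff_nonneg (H : IsDMS r q T h u) (hr : 0 < r) (hh : 0 < h) {m : ℕ}
    (hm : m < ⌊T / h⌋₊) {x : ℝ} (hx : x ∈ Icc (-1 : ℝ) 1) : 0 ≤ u (m + 1) x - u m x :=
  sub_nonneg.2 (H.isDiscreteFlow.mono (continuous_obstacle r q) hh (beta_pos hr).le hm x hx)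

theorem IsDMS.monotone (H : IsDMS r q T h u) (hr : 0 < r) (hh : 0 < h) {n m : ℕ} (hnm : n ≤ m)
    (hm : m ≤ ⌊T / h⌋₊) {x : ℝ} (hx : x ∈ Icc (-1 : ℝ) 1) : u n x ≤ u m x := by
  have := sub_le_of_step_le (a := fun k => -u k x) (g := fun _ => 0) hnm fun k _ hk => by
    linarith [H.diff_nonneg hr hh (hk.trans_le hm) hx]
  linarith

/-- Hölder continuity in time with exponent `1 / 2`, by summing the bounds `C + 1 / (2 √(k h))`
for the difference quotients. -/
theorem IsDMS.time_holder (H : IsDMS r q T h u) (hr : 0 < r) (hh : 0 < h) (hT : 0 ≤ T)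
    (hC0 : 0 ≤ C)
    (hC : ∀ m < ⌊T / h⌋₊, ∀ x ∈ Icc (-1 : ℝ) 1,
      (u (m + 1) x - u m x) / h ≤ heatKern h m x + C)
    {n m : ℕ} (hnm : n ≤ m) (hm : m ≤ ⌊T / h⌋₊) {x : ℝ} (hx : x ∈ Icc (-1 : ℝ) 1) :
    |u m x - u n x| ≤ (C * √T + 1) * √|((m : ℝ) - n) * h| := by
  have hnm' : (n : ℝ) ≤ m := by exact_mod_cast hnm
  have hmh : (m : ℝ) * h ≤ T := by
    have := (Nat.le_floor_iff (by positivity)).1 hm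
    rwa [le_div_iff₀ hh] at this
  have hτ0 : 0 ≤ ((m : ℝ) - n) * h := mul_nonneg (by linarith) hh.le
  have hτT : ((m : ℝ) - n) * h ≤ T := by
    have : 0 ≤ (n : ℝ) * h := by positivity
    linarith
  rw [abs_of_nonneg (sub_nonneg.2 (H.monotone hr hh hnm hm hx)), abs_of_nonneg hτ0]
  have h1 := sub_le_of_step_le (a := fun k => u k x)
    (g := fun k => C * (k * h) + √((k : ℕ) * h)) hnm fun k _ hk => by
      have e1 := (hC k (hk.trans_le hm) x hx).trans (add_le_add_left (heatKern_le hh k x) C)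
      rw [div_le_iff₀ hh] at e1
      have e2 := one_div_two_mul_sqrt_le hh k
      push_cast at e1 e2 ⊢
      nlinarith
  have h2 : √((m : ℝ) * h) - √((n : ℝ) * h) ≤ √(((m : ℝ) - n) * h) := by
    refine (sqrt_sub_sqrt_le (by positivity) (by gcongr)).trans (le_of_eq ?_)
    congr 1; ring
  have h3 : ((m : ℝ) - n) * h ≤ √T * √(((m : ℝ) - n) * h) := by
    nth_rewrite 1 [← Real.mul_self_sqrt hτ0]
    gcongr
  nlinarith

/-- Lipschitz continuity in time away from the initial time. -/
theorem IsDMS.time_lipschitz (H : IsDMS r q T h u) (hr : 0 < r) (hh : 0 < h) (hC0 : 0 ≤ C)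
    (hC : ∀ m < ⌊T / h⌋₊, ∀ x ∈ Icc (-1 : ℝ) 1,
      (u (m + 1) x - u m x) / h ≤ heatKern h m x + C) {l : ℝ} (hl : 1 ≤ l)
    {n m : ℕ} (hnm : n ≤ m) (hm : m ≤ ⌊T / h⌋₊) (hn : (h * l)⁻¹ ≤ n) {x : ℝ}
    (hx : x ∈ Icc (-1 : ℝ) 1) :
    |u m x - u n x| ≤ (C + 1) * (|((m : ℝ) - n) * h| * √l) := by
  have hnm' : (n : ℝ) ≤ m := by exact_mod_cast hnm
  have hτ0 : 0 ≤ ((m : ℝ) - n) * h := mul_nonneg (by linarith) hh.le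
  have hl0 : 0 < l := by linarith
  have hsl : 1 ≤ √l := by rw [← Real.sqrt_one]; exact Real.sqrt_le_sqrt hl
  rw [abs_of_nonneg (sub_nonneg.2 (H.monotone hr hh hnm hm hx)), abs_of_nonneg hτ0]
  have h1 := sub_le_of_step_le (a := fun k => u k x)
    (g := fun k => (C + 1) * √l * (k * h)) hnm fun k hnk hk => by
      have e1 := (hC k (hk.trans_le hm) x hx).trans (add_le_add_left (heatKern_le hh k x) C)
      rw [div_le_iff₀ hh] at e1
      have e2 : 1 / (2 * √((k + 1 : ℕ) * h)) ≤ √l := by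
        have hk1 : (h * l)⁻¹ ≤ (k + 1 : ℕ) := by
          refine hn.trans ?_
          exact_mod_cast hnk.trans (Nat.le_succ k)
        have e3 : 1 ≤ (k + 1 : ℕ) * h * l := by
          rw [inv_le_iff_one_le_mul₀ (by positivity)] at hk1
          linarith
        have e4 : 1 ≤ √((k + 1 : ℕ) * h) * √l := by
          rw [← Real.sqrt_mul (by positivity), ← Real.sqrt_one]
          exact Real.sqrt_le_sqrt e3
        rw [div_le_iff₀ (by positivity)]
        linarith
      have e5 : C ≤ C * √l := le_mul_of_one_le_right hC0 hsl
      have e6 : (1 / (2 * √((k + 1 : ℕ) * h)) + C) * h ≤ (C + 1) * √l * h := by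
        gcongr
        linarith
      push_cast at e1 e6 ⊢
      linarith
  linarith

end Estimates

end DMSBS

theorem theorem4p2 (r q T : ℝ) (hq : 0 < q) (hqr : q < r) (hrq : r < q * Real.exp 1)
    (hT : 0 < T) :
    ∃ x₄ : ℝ, 0 < x₄ ∧ x₄ < Real.log (r / q) ∧ ∃ h₁ : ℝ, 0 < h₁ ∧ h₁ < 1 ∧
      -- regularity of the iterates
      (∀ h : ℝ, 0 < h → h < h₁ → ∀ u : ℕ → ℝ → ℝ, DMSBS.IsDMS r q T h u →
        ∀ m : ℕ, 1 ≤ m → m ≤ ⌊T / h⌋₊ → DMSBS.MemW 2 ⊤ (u m)) ∧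
      -- pointwise bounds for the difference quotient and the second derivative
      (∃ L₄ L₅ : ℝ, 0 < L₄ ∧ 0 < L₅ ∧
        ∀ h : ℝ, 0 < h → h < h₁ → ∀ u : ℕ → ℝ → ℝ, DMSBS.IsDMS r q T h u →
        ∀ m : ℕ, 1 ≤ m → m ≤ ⌊T / h⌋₊ →
          (∀ x ∈ Set.Icc (-1 : ℝ) 1,
            (|x| < x₄ → |u m x - u (m - 1) x| / h ≤
              L₄ * max (1 / √((m : ℝ) * h)) (√(|Real.log h| / L₅))) ∧
            (x₄ ≤ |x| → |u m x - u (m - 1) x| / h ≤ L₄ * √(|Real.log h| / L₅))) ∧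
          (∀ᵐ x ∂DMSBS.μΩ,
            (|x| < x₄ → |DMSBS.weakDeriv (DMSBS.weakDeriv (u m)) x| ≤
              L₄ * max (1 / √((m : ℝ) * h)) (√(|Real.log h| / L₅))) ∧
            (x₄ ≤ |x| → |DMSBS.weakDeriv (DMSBS.weakDeriv (u m)) x| ≤
              L₄ * √(|Real.log h| / L₅)))) ∧
      -- space-time estimates
      (∃ L₆ L₇ : ℝ, 0 < L₆ ∧ 0 < L₇ ∧
        ∀ h : ℝ, 0 < h → h < h₁ → ∀ u : ℕ → ℝ → ℝ, DMSBS.IsDMS r q T h u →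
        ∀ m n : ℕ, m ≤ ⌊T / h⌋₊ → n ≤ ⌊T / h⌋₊ →
        ∀ x ∈ Set.Icc (-1 : ℝ) 1, ∀ y ∈ Set.Icc (-1 : ℝ) 1,
          ((m : ℝ) ≤ L₇ * (h * |Real.log h|)⁻¹ → (n : ℝ) ≤ L₇ * (h * |Real.log h|)⁻¹ →
            |u m x - u n y| ≤ L₆ * (√|((m : ℝ) - n) * h| + |x - y|)) ∧
          (L₇ * (h * |Real.log h|)⁻¹ ≤ (m : ℝ) → L₇ * (h * |Real.log h|)⁻¹ ≤ (n : ℝ) →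
            |u m x - u n y| ≤
              L₆ * (|((m : ℝ) - n) * h| * √|Real.log h| + |x - y|))) := by
  open DMSBS in
  have hr : 0 < r := hq.trans hqr
  have hx₀ : 0 < Real.log (r / q) := Real.log_pos ((one_lt_div hq).2 hqr)
  obtain ⟨C, hC0, hC⟩ := exists_secondDiff_obstacle_sub_max_le r q
  obtain ⟨L, hL0, hL⟩ := exists_lipschitz_obstacle r q
  obtain ⟨M, hM0, hM⟩ := exists_obstacle_le r q
  have hβ : 0 < beta r q := beta_pos hr
  have hφ := continuous_obstacle r q
  set x₄ := Real.log (r / q) / 2 with hx₄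
  have hx₄0 : 0 < x₄ := by positivity
  -- for `h < exp (-1)` the logarithmic factor is at least `1` and absorbs bounded terms
  have hlog : ∀ h : ℝ, 0 < h → h < Real.exp (-1) → 1 ≤ |Real.log h| := by
    intro h hh hh1
    have := (Real.log_lt_iff_lt_exp hh).2 hh1
    exact le_abs.2 (Or.inr (by linarith))
  have hdiff : ∀ h : ℝ, 0 < h → ∀ u : ℕ → ℝ → ℝ, IsDMS r q T h u → ∀ m < ⌊T / h⌋₊,
      ∀ x ∈ Set.Icc (-1 : ℝ) 1, (u (m + 1) x - u m x) / h ≤ heatKern h m x + C :=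
    fun h hh u H m hm => H.isDiscreteFlow.diff_le hh hβ.le hC0 hC hm
  have hreg : ∀ h : ℝ, 0 < h → ∀ u : ℕ → ℝ → ℝ, IsDMS r q T h u → ∀ m < ⌊T / h⌋₊,
      MemW 2 ⊤ (u (m + 1)) ∧ ∀ᵐ x ∂μΩ, |weakDeriv (weakDeriv (u (m + 1))) x| ≤
        (u (m + 1) x - u m x) / h + (C + 1 + beta r q * M) := by
    intro h hh u H m hm
    have hF := H.isDiscreteFlow
    have hMu := hF.le_of_le hφ hh hβ hM0 hM hm
    set B := 1 / (2 * √((m + 1 : ℕ) * h)) + C + beta r q * M + 1 with hB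
    have hBpos : 0 ≤ B := by positivity
    have key := memW_two_top_of_secondDiff (K := C + 1) (B := B) (by linarith) hBpos
      (hF.cont hφ hm) (fun z hz => hF.le_secondDiff hh hβ.le hC0 hC hm hz)
      (fun z hz c hc => (hF.step m hm).super z hz c hc) fun z hz => by
        have hz' := Set.Ioo_subset_Icc_self hz
        have e1 := hdiff h hh u H m hm z hz'
        have e2 := heatKern_le hh m z
        have e3 := mul_le_mul_of_nonneg_left (hMu z hz') hβ.le
        linarith
    refine ⟨key.1, ?_⟩
    filter_upwards [key.2, ae_μΩ fun x hx => hx] with x hx hxm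
    have hx' := Set.Ioo_subset_Icc_self hxm
    have e1 : 0 ≤ (u (m + 1) x - u m x) / h := div_nonneg (H.diff_nonneg hr hh hm hx') hh.le
    have e2 := mul_le_mul_of_nonneg_left (hMu x hx') hβ.le
    have e3 : 0 ≤ beta r q * M := by positivity
    exact abs_le.2 ⟨by linarith [hx.1], by linarith [hx.2]⟩
  refine ⟨x₄, hx₄0, by rw [hx₄]; linarith, Real.exp (-1), Real.exp_pos _, by simp, ?_, ?_, ?_⟩
  · intro h hh _ u H m hm1 hm
    obtain ⟨k, rfl⟩ := Nat.exists_eq_add_of_le' hm1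
    exact (hreg h hh u H k hm).1
  · set P := C + 1 + beta r q * M with hP
    have hP0 : 0 ≤ P := by positivity
    refine ⟨1 + C + 1 / (2 * x₄) + P, 1, by positivity, one_pos, ?_⟩
    intro h hh hh1 u H m hm1 hm
    obtain ⟨k, rfl⟩ := Nat.exists_eq_add_of_le' hm1
    rw [div_one, Nat.add_sub_cancel]
    have hs : 1 ≤ √|Real.log h| := by
      rw [← Real.sqrt_one]; exact Real.sqrt_le_sqrt (hlog h hh hh1)
    set s := √|Real.log h| with hsdef
    set a := 1 / √((k + 1 : ℕ) * h) with ha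
    have ha0 : 0 ≤ a := by positivity
    have hinner : ∀ x ∈ Set.Icc (-1 : ℝ) 1, (u (k + 1) x - u k x) / h + P ≤
        (1 + C + 1 / (2 * x₄) + P) * max a s := by
      intro x hx
      have e1 := (hdiff h hh u H k hm x hx).trans (add_le_add_left (heatKern_le hh k x) C)
      have e2 : 1 / (2 * √((k + 1 : ℕ) * h)) = a / 2 := by rw [ha, div_div]; ring
      have e3 : a ≤ max a s := le_max_left _ _
      have e4 : 1 ≤ max a s := hs.trans (le_max_right _ _)
      have e5 : C + P ≤ (C + P) * max a s := le_mul_of_one_le_right (by positivity) e4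
      have e6 : 0 ≤ 1 / (2 * x₄) * max a s := by positivity
      rw [e2] at e1
      linarith
    have houter : ∀ x ∈ Set.Icc (-1 : ℝ) 1, x₄ ≤ |x| → (u (k + 1) x - u k x) / h + P ≤
        (1 + C + 1 / (2 * x₄) + P) * s := by
      intro x hx hxx
      have e1 := hdiff h hh u H k hm x hx
      have e2 : heatKern h k x ≤ 1 / (2 * x₄) := by
        rw [le_div_iff₀ (by positivity)]
        have := abs_mul_heatKern_le hh k x
        have := mul_le_mul_of_nonneg_right hxx (heatKern_nonneg (h := h) k x)
        linarith
      have e3 : C + 1 / (2 * x₄) + P ≤ (C + 1 / (2 * x₄) + P) * s :=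
        le_mul_of_one_le_right (by positivity) hs
      linarith
    refine ⟨fun x hx => ?_, ?_⟩
    · rw [abs_of_nonneg (H.diff_nonneg hr hh hm hx)]
      exact ⟨fun _ => by linarith [hinner x hx], fun hxx => by linarith [houter x hx hxx]⟩
    · filter_upwards [(hreg h hh u H k hm).2, ae_μΩ fun x hx => hx] with x hx hxm
      have hx' := Set.Ioo_subset_Icc_self hxm
      exact ⟨fun _ => hx.trans (hinner x hx'), fun hxx => hx.trans (houter x hx' hxx)⟩
  · set D := L + 2 * (C + 1 + 1) with hD
    have hD0 : 0 ≤ D := by positivity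
    refine ⟨(C * √T + 1) + (C + 1) + D, 1, by positivity, one_pos, ?_⟩
    intro h hh hh1 u H m n hm hn x hx y hy
    have hF := H.isDiscreteFlow
    have hspace : |u n x - u n y| ≤ D * |x - y| :=
      abs_sub_le_of_convexOn (by linarith)
        (convexOn_add_sq (hF.cont hφ hn) fun z hz => hF.le_secondDiff hh hβ.le hC0 hC hn hz)
        (fun z hz => hF.ge hn hz) (hF.left hn) (hF.right hn) hL x hx y hy
    have htri : |u m x - u n y| ≤ |u m x - u n x| + |u n x - u n y| := abs_sub_le _ _ _
    have hxy := abs_nonneg (x - y)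
    have hCT : 0 ≤ C * √T := by positivity
    have hcomm : |((m : ℝ) - n) * h| = |((n : ℝ) - m) * h| := by
      rw [← abs_neg]; congr 1; ring
    refine ⟨fun _ _ => ?_, fun hm1 hn1 => ?_⟩
    · have htime : |u m x - u n x| ≤ (C * √T + 1) * √|((m : ℝ) - n) * h| := by
        rcases le_total n m with hnm | hnm
        · exact H.time_holder hr hh hT.le hC0 (hdiff h hh u H) hnm hm hx
        · rw [abs_sub_comm, hcomm]
          exact H.time_holder hr hh hT.le hC0 (hdiff h hh u H) hnm hn hx
      have := Real.sqrt_nonneg |((m : ℝ) - n) * h|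
      nlinarith
    · rw [one_mul] at hm1 hn1
      have htime : |u m x - u n x| ≤ (C + 1) * (|((m : ℝ) - n) * h| * √|Real.log h|) := by
        rcases le_total n m with hnm | hnm
        · exact H.time_lipschitz hr hh hC0 (hdiff h hh u H) (hlog h hh hh1) hnm hm hn1 hx
        · rw [abs_sub_comm, hcomm]
          exact H.time_lipschitz hr hh hC0 (hdiff h hh u H) (hlog h hh hh1) hnm hn hm1 hx
      have : 0 ≤ |((m : ℝ) - n) * h| * √|Real.log h| := by positivity
      nlinarith
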